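/- **Conventions.** All systems are finite-dimensional, of dimension at least one, and have a fixed computational basis. An operation (channel) $\mathcal N_{R|Q}$ is a completely positive trace-preserving linear map from operators on $Q$ to operators on $R$. Let $\phi_{\tilde QQ}=|\phi\rangle\langle\phi|$, $|\phi\rangle=\dim(Q)^{-1/2}\sum_i|i\rangle|i\rangle$. A state of a $K\times K$ system has *entanglement fidelity* $\mathrm{Tr}\,\phi\sigma$, and an operation $\mathcal M_{B'|A}$ with $\dim A=\dim B'=K$ has *channel fidelity* $\mathrm{Tr}\,\phi_{B'\tilde A}\,(\mathcal M_{B'|A}\otimes\mathrm{id}_{\tilde A})\phi_{A\tilde A}$. A bipartite operator (Alice : Bob) is *PPT* if its partial transpose on Bob's systems is positive semidefinite. A bipartite operation $\mathcal Z_{A'B'|AB}$ is *PPT-preserving* if, for all finite-dimensional ancillas $\tilde A$ (Alice) and $\tilde B$ (Bob), $\mathcal Z\otimes\mathrm{id}_{\tilde A\tilde B}$ takes every state that is PPT with respect to $A\tilde A:B\tilde B$ to one that is PPT with respect to $A'\tilde A:B'\tilde B$. A *forward-assisted code* of size $K$ for a channel $\mathcal N_{B|A'}$ consists of operations $\mathcal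 E_{A'Q|A}$ (encoder), $\mathcal F_{R|Q}$ (side channel) and $\mathcal D_{B'|RB}$ (decoder), where $\dim A=\dim B'=K$ and $Q,R$ are arbitrary. It yields the operation $\mathcal M_{B'|A}=\mathcal D\,(\mathcal F\otimes\mathcal N)\,\mathcal E$, whose channel fidelity is the channel fidelity of the code. It is *PPT-preserving* if the bipartite operation $\mathcal Z_{A'B'|AB}=\mathcal D_{B'|RB}\mathcal F_{R|Q}\mathcal E_{A'Q|A}$ is. Let $F^{\mathrm{PPTp}}(\mathcal N,K)$ be the optimal (supremal) channel fidelity of PPT-preserving codes of size $K$ for $\mathcal N$, and $$Q^{\mathrm{PPTp}}(\mathcal N)=\sup\{r\ge 0:\lim_{n\to\infty}F^{\mathrm{PPTp}}(\mathcal N^{\otimes n},\lfloor 2^{rn}\rfloor)=1\}.$$ For a bipartite state $\rho$, say that a PPT-preserving operation *distills a $K\times K$ state with entanglement fidelity $f$ from $\rho$* if there is a PPT-preserving operation $\mathcal Y$ with output systems $\tilde A,B'$ of dimension $K$ such that $\mathrm{Tr}\,\phi_{\tilde AB'}\,\mathcal Y\rho=f$. Let $F_\Gamma(\rho,K)$ be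 the optimal (supremal) such $f$, and $$D_\Gamma(\rho)=\sup\{r\ge 0:\lim_{n\to\infty}F_\Gamma(\rho^{\otimes n},\lfloor 2^{rn}\rfloor)=1\}.$$ A channel is *classical* if composing it with the completely dephasing operation on its input leaves it unchanged, and so does composing it with the completely dephasing operation on its output. For a channel $\mathcal N_{B|A'}$ let $\nu_{B\tilde A'}=(\mathcal N_{B|A'}\otimes\mathrm{id}_{\tilde A'})\phi_{A'\tilde A'}$ be its Choi state, with $\tilde A'$ held by Alice and $B$ by Bob. Say that $\mathcal N$ *can be implemented exactly from one copy of its Choi state and forward classical communication* if there are an operation $\mathcal E_{Q|A'\tilde A'}$ (Alice), a classical channel $\mathcal F_{R|Q}$ and an operation $\mathcal D_{B|RB}$ (Bob) such that $\mathcal D\,\mathcal F\,\mathcal E\,(X_{A'}\otimes\nu_{B\tilde A'})=\mathcal N X_{A'}$ for all $X_{A'}$. **Proposition.** Let $\mathcal N_{B|A'}$ be any channel, with Choi state $\nu_{B\tilde A'}$. (i) For every $K\ge1$, if a PPT-preserving operation distills a $K\times K$ state with entanglement fidelity $f$ from $\nu_{B\tilde A'}$, then there is a PPT-preserving code of size $K$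 and channel fidelity $f$ for $\mathcal N$. Therefore $F^{\mathrm{PPTp}}(\mathcal N,K)\ge F_\Gamma(\nu_{B\tilde A'},K)$ for all $K\ge1$, and $Q^{\mathrm{PPTp}}(\mathcal N)\ge D_\Gamma(\nu_{B\tilde A'})$. (ii) If $\mathcal N$ can be implemented exactly from one copy of its Choi state and forward classical communication, then the converse of the first claim of (i) also holds, and therefore $F^{\mathrm{PPTp}}(\mathcal N,K)=F_\Gamma(\nu_{B\tilde A'},K)$ for all $K\ge1$, and $Q^{\mathrm{PPTp}}(\mathcal N)=D_\Gamma(\nu_{B\tilde A'})$. (iii) Let $\mathring A'$ be a copy of $A'$. Suppose that there are an operation $\mathcal M_{C|A'\tilde A'}$ and unitaries $U_i$ on $\mathring A'$, one for each computational basis state $i$ of $C$, that form a teleportation protocol: if $\mathcal U_{\mathring A'|\mathring A'C}$ measures $C$ in the computational basis and conjugates $\mathring A'$ by $U_i$ on outcome $i$, then $\mathcal U_{\mathring A'|\mathring A'C}\,\mathcal M_{C|A'\tilde A'}\,(X_{A'}\otimes\phi_{\mathring A'\tilde A'})=X_{\mathring A'}$ for all $X_{A'}$, where $X_{\mathring A'}$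 is the copy of $X_{A'}$ on $\mathring A'$. Suppose further that there are unitaries $V_i$ on $B$ with $\mathcal N(U_iXU_i^\dagger)=V_i\,\mathcal N(X)\,V_i^\dagger$ for all $i$ and all $X$. Then $\mathcal N$ can be implemented exactly from one copy of its Choi state and forward classical communication. -/

import Mathlib

open scoped Matrix Kronecker Topology ComplexOrder

/-!  Finite-dimensional quantum systems are represented by finite index types: the
system `p` has Hilbert space `ℂ^p` with computational basis indexed by `p`; composite
systems are products of index types.  In a bipartite system `α × β`, the first factor
belongs to Alice and the second to Bob. -/

namespace PPTCode

/-- Linear maps from operators on the system `p` to operators on the system `q`. -/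
abbrev SuperOp (p q : Type*) := Matrix p p ℂ →ₗ[ℂ] Matrix q q ℂ

section Basic

variable {p q r s : Type*}

/-- A density matrix: positive semidefinite with unit trace. -/
def IsState [Fintype p] (ρ : Matrix p p ℂ) : Prop :=
  ρ.PosSemidef ∧ ρ.trace = 1

/-- The tensor product `Φ ⊗ Ψ`, determined on the matrix units
`|k⟩⟨l| ⊗ |m⟩⟨n|` by `Φ(|k⟩⟨l|) ⊗ Ψ(|m⟩⟨n|)`. -/
def mapTensor [Fintype p] [DecidableEq p] [Fintype r] [DecidableEq r]
    (Φ : SuperOp p q) (Ψ : SuperOp r s) : SuperOp (p × r) (q × s) where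
  toFun X := Matrix.of fun i j =>
    ∑ k : p × r, ∑ l : p × r,
      Φ (Matrix.single k.1 l.1 1) i.1 j.1 * Ψ (Matrix.single k.2 l.2 1) i.2 j.2 * X k l
  map_add' X Y := by
    ext i j
    simp [mul_add, Finset.sum_add_distrib]
  map_smul' c X := by
    ext i j
    simp only [Matrix.smul_apply, Matrix.of_apply, smul_eq_mul, RingHom.id_apply,
      Finset.mul_sum]
    refine Finset.sum_congr rfl fun k _ => Finset.sum_congr rfl fun l _ => ?_
    ring

/-- The `n`-fold tensor power `Φ^{⊗ n}`, determined on the matrix units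
`⊗ₜ |k t⟩⟨l t|` by `⊗ₜ Φ(|k t⟩⟨l t|)`. -/
def tensorPow [Fintype p] [DecidableEq p]
    (Φ : SuperOp p q) (n : ℕ) : SuperOp (Fin n → p) (Fin n → q) where
  toFun X := Matrix.of fun i j =>
    ∑ k : Fin n → p, ∑ l : Fin n → p,
      (∏ t, Φ (Matrix.single (k t) (l t) 1) (i t) (j t)) * X k l
  map_add' X Y := by
    ext i j
    simp [mul_add, Finset.sum_add_distrib]
  map_smul' c X := by
    ext i j
    simp only [Matrix.smul_apply, Matrix.of_apply, smul_eq_mul, RingHom.id_apply,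
      Finset.mul_sum]
    refine Finset.sum_congr rfl fun k _ => Finset.sum_congr rfl fun l _ => ?_
    ring

/-- Relabelling of the basis (used to reorder and regroup tensor factors). -/
def relabel (e : p ≃ q) : SuperOp p q :=
  (Matrix.reindexLinearEquiv ℂ ℂ e e).toLinearMap

/-- Complete positivity: `Φ ⊗ id` is positive for every finite-dimensional ancilla. -/
def IsCompletelyPositive [Fintype p] [DecidableEq p] (Φ : SuperOp p q) : Prop :=
  ∀ (k : ℕ) (X : Matrix (p × Fin k) (p × Fin k) ℂ), X.PosSemidef →
    (mapTensor Φ (LinearMap.id : SuperOp (Fin k) (Fin k)) X).PosSemidef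

/-- Operations (channels): completely positive trace-preserving maps. -/
def IsChannel [Fintype p] [DecidableEq p] [Fintype q] (Φ : SuperOp p q) : Prop :=
  IsCompletelyPositive Φ ∧ ∀ X, (Φ X).trace = X.trace

/-- The completely dephasing operation in the computational basis. -/
def dephase (p : Type*) [DecidableEq p] : SuperOp p p :=
  (Matrix.diagonalLinearMap p ℂ ℂ).comp (Matrix.diagLinearMap p ℂ ℂ)

/-- Classical channels: unchanged by dephasing the input or the output. -/
def IsClassical [DecidableEq p] [DecidableEq q] (F : SuperOp p q) : Prop :=
  F ∘ₗ dephase p = F ∧ dephase q ∘ₗ F = F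

/-- The maximally entangled state `φ = |φ⟩⟨φ|`, `|φ⟩ = (dim p)^{-1/2} ∑ᵢ |i⟩|i⟩`. -/
noncomputable def maxEnt (p : Type*) [Fintype p] [DecidableEq p] : Matrix (p × p) (p × p) ℂ :=
  Matrix.of fun x y => if x.1 = x.2 ∧ y.1 = y.2 then ((Fintype.card p : ℂ))⁻¹ else 0

/-- Entanglement fidelity `Tr φ σ` of an operator `σ` on two copies of `p`. -/
noncomputable def entFidelity [Fintype p] [DecidableEq p]
    (σ : Matrix (p × p) (p × p) ℂ) : ℝ :=
  ((maxEnt p * σ).trace).re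

/-- Channel fidelity `Tr φ (M ⊗ id) φ`. -/
noncomputable def channelFidelity [Fintype p] [DecidableEq p] (M : SuperOp p p) : ℝ :=
  entFidelity (mapTensor M (LinearMap.id : SuperOp p p) (maxEnt p))

/-- The Choi state `ν = (id ⊗ N) φ` of `N`; the untouched half of `φ` is Alice's. -/
noncomputable def choiState [Fintype p] [DecidableEq p] (N : SuperOp p q) :
    Matrix (p × q) (p × q) ℂ :=
  mapTensor (LinearMap.id : SuperOp p p) N (maxEnt p)

end Basic

section PPT

variable {α β α' β' : Type*}

/-- Partial transpose on Bob's factor. -/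
def partialTranspose (X : Matrix (α × β) (α × β) ℂ) : Matrix (α × β) (α × β) ℂ :=
  Matrix.of fun x y => X (x.1, y.2) (y.1, x.2)

/-- Positive partial transpose across the Alice / Bob cut. -/
def IsPPT (X : Matrix (α × β) (α × β) ℂ) : Prop :=
  (partialTranspose X).PosSemidef

/-- `Z ⊗ id` for a bipartite map `Z`, with an ancilla `Fin m` held by Alice and an
ancilla `Fin n` held by Bob, as a map between bipartite systems. -/
def extend [Fintype α] [DecidableEq α] [Fintype β] [DecidableEq β]
    (Z : SuperOp (α × β) (α' × β')) (m n : ℕ) :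
    SuperOp ((α × Fin m) × (β × Fin n)) ((α' × Fin m) × (β' × Fin n)) :=
  relabel (Equiv.prodProdProdComm α' β' (Fin m) (Fin n)) ∘ₗ
    mapTensor Z (LinearMap.id : SuperOp (Fin m × Fin n) (Fin m × Fin n)) ∘ₗ
    relabel (Equiv.prodProdProdComm α (Fin m) β (Fin n))

/-- A bipartite map is PPT-preserving if, with arbitrary ancillas on both sides, it
takes PPT states to PPT operators. -/
def IsPPTPreserving [Fintype α] [DecidableEq α] [Fintype β] [DecidableEq β]
    (Z : SuperOp (α × β) (α' × β')) : Prop :=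
  ∀ (m n : ℕ) (ρ : Matrix ((α × Fin m) × (β × Fin n)) ((α × Fin m) × (β × Fin n)) ℂ),
    IsState ρ → IsPPT ρ → IsPPT (extend Z m n ρ)

end PPT

section Codes

variable {a b : Type*} [Fintype a] [DecidableEq a] [Fintype b] [DecidableEq b]

/-- A forward-assisted code of size `K` for channels from `a` to `b`: an encoder
`A → A'Q`, a side channel `Q → R` and a decoder `RB → B'`, where `A` and `B'` have
dimension `K` and the side systems `Q`, `R` have arbitrary finite dimension. -/
structure ForwardCode (a b : Type*) [Fintype a] [DecidableEq a]
    [Fintype b] [DecidableEq b] (K : ℕ) where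
  dimQ : ℕ
  dimR : ℕ
  enc : SuperOp (Fin K) (a × Fin dimQ)
  side : SuperOp (Fin dimQ) (Fin dimR)
  dec : SuperOp (Fin dimR × b) (Fin K)
  enc_isChannel : IsChannel enc
  side_isChannel : IsChannel side
  dec_isChannel : IsChannel dec

/-- The bipartite operation `AB → A'B'` of a code: encoder, side channel, decoder. -/
def ForwardCode.bipartite {K : ℕ} (C : ForwardCode a b K) :
    SuperOp (Fin K × b) (a × Fin K) :=
  mapTensor (LinearMap.id : SuperOp a a) C.dec ∘ₗ
    mapTensor (LinearMap.id : SuperOp a a)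
      (mapTensor C.side (LinearMap.id : SuperOp b b)) ∘ₗ
    relabel (Equiv.prodAssoc a (Fin C.dimQ) b) ∘ₗ
    mapTensor C.enc (LinearMap.id : SuperOp b b)

/-- The operation `A → B'` that results from using a code over the channel `N`. -/
def ForwardCode.apply {K : ℕ} (C : ForwardCode a b K) (N : SuperOp a b) :
    SuperOp (Fin K) (Fin K) :=
  C.dec ∘ₗ relabel (Equiv.prodComm b (Fin C.dimR)) ∘ₗ mapTensor N C.side ∘ₗ C.enc

/-- There is a PPT-preserving code of size `K` and channel fidelity `f` for `N`. -/
def CodeAchieves (N : SuperOp a b) (K : ℕ) (f : ℝ) : Prop :=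
  ∃ C : ForwardCode a b K, IsPPTPreserving C.bipartite ∧ channelFidelity (C.apply N) = f

/-- The optimal channel fidelity of PPT-preserving codes of size `K` for `N`. -/
noncomputable def codeFidelity (N : SuperOp a b) (K : ℕ) : ℝ :=
  sSup {f | CodeAchieves N K f}

/-- The quantum capacity of the memoryless channel `N` under PPT-preserving codes. -/
noncomputable def codeCapacity (N : SuperOp a b) : EReal :=
  sSup ((fun r : ℝ => (r : EReal)) ''
    {r | 0 ≤ r ∧ Filter.Tendsto (fun n : ℕ =>
      codeFidelity (tensorPow N n) ⌊(2 : ℝ) ^ (r * n)⌋₊)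
      Filter.atTop (𝓝 1)})

/-- A PPT-preserving operation takes the bipartite state `ρ` to a `K × K` state with
entanglement fidelity `f`. -/
def Distills (ρ : Matrix (a × b) (a × b) ℂ) (K : ℕ) (f : ℝ) : Prop :=
  ∃ Y : SuperOp (a × b) (Fin K × Fin K),
    IsChannel Y ∧ IsPPTPreserving Y ∧ entFidelity (Y ρ) = f

/-- Rains' PPT distillation fidelity of `ρ`. -/
noncomputable def distillFidelity (ρ : Matrix (a × b) (a × b) ℂ) (K : ℕ) : ℝ :=
  sSup {f | Distills ρ K f}

/-- `ρ^{⊗ n}`, as a bipartite state: Alice holds `a^n`, Bob holds `b^n`. -/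
def statePow {a b : Type*} (ρ : Matrix (a × b) (a × b) ℂ) (n : ℕ) :
    Matrix ((Fin n → a) × (Fin n → b)) ((Fin n → a) × (Fin n → b)) ℂ :=
  Matrix.of fun x y => ∏ t, ρ (x.1 t, x.2 t) (y.1 t, y.2 t)

/-- Rains' asymptotic rate of distillation by PPT-preserving operations. -/
noncomputable def distillRate (ρ : Matrix (a × b) (a × b) ℂ) : EReal :=
  sSup ((fun r : ℝ => (r : EReal)) ''
    {r | 0 ≤ r ∧ Filter.Tendsto (fun n : ℕ =>
      distillFidelity (statePow ρ n) ⌊(2 : ℝ) ^ (r * n)⌋₊)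
      Filter.atTop (𝓝 1)})

/-- `X_{A'} ⊗ ω_{Ã'B}`, grouped as an operator on the bipartite system `A'Ã' : B`. -/
def adjoin {a b c : Type*} (ω : Matrix (c × b) (c × b) ℂ) (X : Matrix a a ℂ) :
    Matrix ((a × c) × b) ((a × c) × b) ℂ :=
  relabel (Equiv.prodAssoc a c b).symm (X ⊗ₖ ω)

/-- `N` can be implemented exactly from one copy of its Choi state and forward classical
communication: Alice applies an operation to the input `A'` and her half `Ã'` of the
Choi state, sends the result over a classical channel, and Bob applies an operation to
what he receives and his half `B`; the overall effect is `N`. -/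
def IsSimulableFromChoi (N : SuperOp a b) : Prop :=
  ∃ (k l : ℕ) (E : SuperOp (a × a) (Fin k)) (F : SuperOp (Fin k) (Fin l))
    (D : SuperOp (Fin l × b) b),
    IsChannel E ∧ IsChannel F ∧ IsClassical F ∧ IsChannel D ∧
    ∀ X : Matrix a a ℂ,
      D (mapTensor F (LinearMap.id : SuperOp b b)
        (mapTensor E (LinearMap.id : SuperOp b b) (adjoin (choiState N) X))) = N X

/-- Measure `C` in the computational basis and, on outcome `i`, conjugate by `W i`. -/
def controlled {k : ℕ} {p : Type*} [Fintype p] [DecidableEq p]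
    (W : Fin k → Matrix.unitaryGroup p ℂ) (X : Matrix (Fin k × p) (Fin k × p) ℂ) :
    Matrix p p ℂ :=
  ∑ i, (W i : Matrix p p ℂ) * X.submatrix (fun j => (i, j)) (fun j => (i, j)) *
    (W i : Matrix p p ℂ)ᴴ

/-- The operation `M : A'Ã' → C` followed by the controlled unitary `U` is a
teleportation protocol for `A'` that uses the maximally entangled state. -/
def IsTeleportation {k : ℕ} (M : SuperOp (a × a) (Fin k))
    (U : Fin k → Matrix.unitaryGroup a ℂ) : Prop :=
  IsChannel M ∧
    ∀ X : Matrix a a ℂ,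
      controlled U (mapTensor M (LinearMap.id : SuperOp a a) (adjoin (maxEnt a) X)) = X

end Codes

end PPTCode

/-! Everything is reduced to complete positivity. For nonempty input systems, a bipartite map is
PPT-preserving exactly when its conjugate by the partial transposition is completely positive
(`isPPTPreserving_of_transposeConj`, `IsPPTPreserving.transposeConj`). By Choi's theorem this is
positivity of a single matrix, and it passes to compositions and tensor products.

(i) The side channel of a code may be fully quantum. Alice sends half of `φ` through the channel and
the other half, with her input, over a noiseless side channel. Bob then holds the Choi state, and he
plays both parties of the distilling operation and of a teleportation through its output. The code
is PPT-preserving because the distilling operation is, and because transposing Bob's systems in the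
teleportation merely conjugates the correction unitaries. Teleportation turns entanglement fidelity
into channel fidelity exactly (`channelFidelity_teleport`).

(ii) Conversely, replace the channel inside a code by its simulation and feed in half of a locally
prepared `φ`: the result is the Choi state of the coded channel. Classical messages are diagonal,
hence invariant under transposition, so the simulation stays completely positive when Bob's systems
are transposed. The simulated code is a contraction of two positive Choi matrices
(`posSemidef_link`), in which the transpositions of the intermediate system `B` cancel
(`ForwardCode.simulate_transpose`).

The asymptotic claims follow from the one-shot ones, since Choi states and simulability are
compatible with tensor powers.

(iii) The channel acts on Bob's half of `φ` and so commutes with Alice's measurement; covariance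
turns the corrections `V i` after the channel into the corrections `U i` before it. -/

namespace PPTCode

/-! ### Tensor calculus of maps, Choi matrices and complete positivity. -/

section Calculus

variable {p q r s t u : Type*}

theorem posSemidef_iff_exists_gram [Finite p] {X : Matrix p p ℂ} :
    X.PosSemidef ↔
      ∃ (m : ℕ) (v : Fin m → p → ℂ), ∀ x y, X x y = ∑ i, v i x * star (v i y) := by
  rw [Matrix.posSemidef_iff_eq_sum_vecMulVec]
  refine exists_congr fun m => exists_congr fun v => ?_
  rw [← Matrix.ext_iff]
  simp [Matrix.sum_apply, Matrix.vecMulVec_apply]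

theorem posSemidef_of_gram [Finite p] {ι : Type*} [Fintype ι] {X : Matrix p p ℂ}
    (v : ι → p → ℂ) (h : ∀ x y, X x y = ∑ i, v i x * star (v i y)) : X.PosSemidef := by
  have : X = Matrix.of (fun x i => v i x) * (Matrix.of fun x i => v i x)ᴴ := by
    ext x y
    simp [h, Matrix.mul_apply]
  rw [this]
  exact Matrix.posSemidef_self_mul_conjTranspose _

theorem superOp_apply [Fintype p] [DecidableEq p] (Φ : SuperOp p q) (X : Matrix p p ℂ)
    (i j : q) : Φ X i j = ∑ k, ∑ l, Φ (Matrix.single k l 1) i j * X k l := by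
  conv_lhs => rw [Matrix.matrix_eq_sum_single X]
  simp only [map_sum, Matrix.sum_apply]
  refine Finset.sum_congr rfl fun k _ => Finset.sum_congr rfl fun l _ => ?_
  have : Matrix.single k l (X k l) = X k l • Matrix.single k l (1 : ℂ) := by
    simp
  rw [this, map_smul, Matrix.smul_apply, smul_eq_mul, mul_comm]

theorem superOp_ext [Finite p] [DecidableEq p] {M : Type*} [AddCommMonoid M] [Module ℂ M]
    {f g : Matrix p p ℂ →ₗ[ℂ] M}
    (h : ∀ k l, f (Matrix.single k l 1) = g (Matrix.single k l 1)) : f = g := by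
  classical
  have := Fintype.ofFinite p
  refine Matrix.ext_linearMap _ fun k l => ?_
  ext
  simpa using h k l

/-- Product operators span, since matrix units of a product system are products of matrix units.
Identities between circuits thereby become computations with `simp` on products. -/
theorem kron_ext [Finite p] [Finite r] {M : Type*} [AddCommMonoid M] [Module ℂ M]
    {f g : Matrix (p × r) (p × r) ℂ →ₗ[ℂ] M}
    (h : ∀ (A : Matrix p p ℂ) (B : Matrix r r ℂ), f (A ⊗ₖ B) = g (A ⊗ₖ B)) : f = g := by
  classical
  refine superOp_ext fun k l => ?_
  have := h (Matrix.single k.1 l.1 1) (Matrix.single k.2 l.2 1)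
  rwa [Matrix.single_kronecker_single, mul_one] at this

@[simp]
theorem mapTensor_kron [Fintype p] [DecidableEq p] [Fintype r] [DecidableEq r]
    (Φ : SuperOp p q) (Ψ : SuperOp r s) (A : Matrix p p ℂ) (B : Matrix r r ℂ) :
    mapTensor Φ Ψ (A ⊗ₖ B) = Φ A ⊗ₖ Ψ B := by
  ext i j
  rw [Matrix.kroneckerMap_apply, superOp_apply Φ, superOp_apply Ψ]
  simp only [mapTensor, LinearMap.coe_mk, AddHom.coe_mk, Matrix.of_apply,
    Matrix.kroneckerMap_apply, Fintype.sum_prod_type, Finset.sum_mul_sum]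
  refine Finset.sum_congr rfl fun k _ => Finset.sum_congr rfl fun l _ =>
    Finset.sum_congr rfl fun m _ => Finset.sum_congr rfl fun n _ => ?_
  ring

@[simp]
theorem relabel_apply (e : p ≃ q) (X : Matrix p p ℂ) (i j : q) :
    relabel e X i j = X (e.symm i) (e.symm j) := rfl

@[simp]
theorem relabel_prodAssoc_kron (A : Matrix p p ℂ) (B : Matrix q q ℂ) (C : Matrix r r ℂ) :
    relabel (Equiv.prodAssoc p q r) ((A ⊗ₖ B) ⊗ₖ C) = A ⊗ₖ (B ⊗ₖ C) := by
  ext i j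
  simp [mul_assoc]

@[simp]
theorem relabel_prodAssoc_symm_kron (A : Matrix p p ℂ) (B : Matrix q q ℂ) (C : Matrix r r ℂ) :
    relabel (Equiv.prodAssoc p q r).symm (A ⊗ₖ (B ⊗ₖ C)) = (A ⊗ₖ B) ⊗ₖ C := by
  ext i j
  simp [mul_assoc]

@[simp]
theorem relabel_prodComm_kron (A : Matrix p p ℂ) (B : Matrix q q ℂ) :
    relabel (Equiv.prodComm p q) (A ⊗ₖ B) = B ⊗ₖ A := by
  ext i j
  simp [mul_comm]

@[simp]
theorem relabel_prodProdProdComm_kron (A : Matrix p p ℂ) (B : Matrix q q ℂ)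
    (C : Matrix r r ℂ) (D : Matrix s s ℂ) :
    relabel (Equiv.prodProdProdComm p q r s) ((A ⊗ₖ B) ⊗ₖ (C ⊗ₖ D)) =
      (A ⊗ₖ C) ⊗ₖ (B ⊗ₖ D) := by
  ext i j
  simp [mul_mul_mul_comm]

@[simp]
theorem adjoin_kron (X : Matrix p p ℂ) (A : Matrix q q ℂ) (B : Matrix r r ℂ) :
    adjoin (A ⊗ₖ B) X = (X ⊗ₖ A) ⊗ₖ B := by
  simp [adjoin]

theorem mapTensor_comp [Fintype p] [DecidableEq p] [Fintype r] [DecidableEq r]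
    [Fintype q] [DecidableEq q] [Fintype s] [DecidableEq s]
    (Φ : SuperOp p q) (Ψ : SuperOp r s) (Φ' : SuperOp q t) (Ψ' : SuperOp s u) :
    mapTensor Φ' Ψ' ∘ₗ mapTensor Φ Ψ = mapTensor (Φ' ∘ₗ Φ) (Ψ' ∘ₗ Ψ) :=
  kron_ext fun A B => by simp

/-- Entrywise complex transposition as a map on operators. -/
def transposeMap (p : Type*) : SuperOp p p where
  toFun X := Xᵀ
  map_add' _ _ := rfl
  map_smul' _ _ := rfl

@[simp]
theorem transposeMap_apply (X : Matrix p p ℂ) : transposeMap p X = Xᵀ := rfl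

/-- Partial transposition on Bob's factor as a map on operators. -/
def partialTransposeMap (p q : Type*) : SuperOp (p × q) (p × q) where
  toFun X := partialTranspose X
  map_add' _ _ := rfl
  map_smul' _ _ := rfl

@[simp]
theorem partialTransposeMap_kron (A : Matrix p p ℂ) (B : Matrix q q ℂ) :
    partialTransposeMap p q (A ⊗ₖ B) = A ⊗ₖ Bᵀ := rfl

@[simp]
theorem partialTransposeMap_partialTransposeMap (X : Matrix (p × q) (p × q) ℂ) :
    partialTransposeMap p q (partialTransposeMap p q X) = X := rfl

/-- The Choi matrix of a map, with unnormalised reference. -/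
def choiMatrix [DecidableEq p] (Φ : SuperOp p q) : Matrix (q × p) (q × p) ℂ :=
  Matrix.of fun x y => Φ (Matrix.single x.2 y.2 1) x.1 y.1

theorem mapTensor_apply [Fintype p] [DecidableEq p] [Fintype r] [DecidableEq r]
    (Φ : SuperOp p q) (Ψ : SuperOp r s) (X : Matrix (p × r) (p × r) ℂ) (i j : q × s) :
    mapTensor Φ Ψ X i j = ∑ k : p × r, ∑ l : p × r,
      Φ (Matrix.single k.1 l.1 1) i.1 j.1 * Ψ (Matrix.single k.2 l.2 1) i.2 j.2 * X k l := rfl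

theorem choiMatrix_mapTensor [Fintype p] [DecidableEq p] [Fintype r] [DecidableEq r]
    (Φ : SuperOp p q) (Ψ : SuperOp r s) :
    choiMatrix (mapTensor Φ Ψ) =
      (choiMatrix Φ ⊗ₖ choiMatrix Ψ).submatrix
        (Equiv.prodProdProdComm q s p r) (Equiv.prodProdProdComm q s p r) := by
  ext x y
  have : (Matrix.single x.2 y.2 1 : Matrix (p × r) (p × r) ℂ) =
      Matrix.single x.2.1 y.2.1 1 ⊗ₖ Matrix.single x.2.2 y.2.2 1 := by
    rw [Matrix.single_kronecker_single, mul_one]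
  simp [choiMatrix, this]

/-- Each vector of a Gram decomposition of the Choi matrix, reshaped into a matrix, is a Kraus
operator. -/
theorem exists_kraus_of_choiMatrix [Fintype p] [DecidableEq p] [Finite q] {Φ : SuperOp p q}
    (h : (choiMatrix Φ).PosSemidef) :
    ∃ (m : ℕ) (A : Fin m → Matrix q p ℂ), ∀ X, Φ X = ∑ i, A i * X * (A i)ᴴ := by
  obtain ⟨m, v, hv⟩ := posSemidef_iff_exists_gram.1 h
  refine ⟨m, fun i => Matrix.of fun x y => v i (x, y), fun X => ?_⟩
  ext i j
  rw [superOp_apply]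
  have h' : ∀ k l, Φ (Matrix.single k l 1) i j = ∑ w, v w (i, k) * star (v w (j, l)) :=
    fun k l => hv (i, k) (j, l)
  simp only [h', Matrix.sum_apply, Matrix.mul_apply, Matrix.conjTranspose_apply, Matrix.of_apply,
    Finset.sum_mul]
  rw [Finset.sum_comm]
  rw [Finset.sum_comm_cycle]
  refine Finset.sum_congr rfl fun w _ => ?_
  refine Finset.sum_congr rfl fun l _ => Finset.sum_congr rfl fun k _ => ?_
  ring

theorem posSemidef_map_of_choiMatrix [Fintype p] [DecidableEq p] [Finite q] {Φ : SuperOp p q}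
    (h : (choiMatrix Φ).PosSemidef) {X : Matrix p p ℂ} (hX : X.PosSemidef) :
    (Φ X).PosSemidef := by
  obtain ⟨m, A, hA⟩ := exists_kraus_of_choiMatrix h
  rw [hA]
  exact Matrix.posSemidef_sum _ fun i _ => hX.mul_mul_conjTranspose_same _

theorem choiMatrix_posSemidef_of_kraus [Fintype p] [DecidableEq p] [Finite q] {ι : Type*}
    [Fintype ι] {Φ : SuperOp p q} (A : ι → Matrix q p ℂ)
    (hA : ∀ X, Φ X = ∑ i, A i * X * (A i)ᴴ) : (choiMatrix Φ).PosSemidef := by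
  refine posSemidef_of_gram (fun i x => A i x.1 x.2) fun x y => ?_
  simp only [choiMatrix, hA, Matrix.of_apply, Matrix.sum_apply]
  refine Finset.sum_congr rfl fun i _ => ?_
  simp [Matrix.mul_apply, Matrix.single_apply, ite_and]

theorem choiMatrix_id_posSemidef [Fintype p] [DecidableEq p] :
    (choiMatrix (LinearMap.id : SuperOp p p)).PosSemidef :=
  choiMatrix_posSemidef_of_kraus (fun _ : Unit => 1) fun X => by simp

/-- Choi's theorem. Conversely to the evaluation at a maximally entangled operator, the Choi matrix
of `Φ ⊗ id` is a reordered Kronecker product of positive matrices, and a positive Choi matrix gives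
a Kraus form. -/
theorem isCompletelyPositive_iff [Fintype p] [DecidableEq p] [Fintype q] {Φ : SuperOp p q} :
    IsCompletelyPositive Φ ↔ (choiMatrix Φ).PosSemidef := by
  constructor
  · intro h
    let e := Fintype.equivFin p
    -- The unnormalised maximally entangled operator of `p` with a copy of itself indexed by `Fin`;
    -- leaving out the normalisation also covers empty `p`.
    let X : Matrix (p × Fin (Fintype.card p)) (p × Fin (Fintype.card p)) ℂ :=
      Matrix.of fun x y => if e x.1 = x.2 ∧ e y.1 = y.2 then 1 else 0
    have hX : X.PosSemidef := by
      refine posSemidef_of_gram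
        (fun (_ : Unit) x => if e x.1 = x.2 then 1 else 0) fun x y => ?_
      by_cases h₁ : e x.1 = x.2 <;> by_cases h₂ : e y.1 = y.2 <;> simp [X, h₁, h₂]
    have := (h _ X hX).submatrix (fun x : q × p => (x.1, e x.2))
    convert this using 1
    ext x y
    simp [mapTensor_apply, choiMatrix, X, Fintype.sum_prod_type, Matrix.single_apply, ite_and]
  · intro h k X hX
    refine posSemidef_map_of_choiMatrix ?_ hX
    rw [choiMatrix_mapTensor]
    exact (h.kronecker choiMatrix_id_posSemidef).submatrix _

theorem IsCompletelyPositive.map_posSemidef [Fintype p] [DecidableEq p] [Fintype q]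
    {Φ : SuperOp p q} (h : IsCompletelyPositive Φ) {X : Matrix p p ℂ} (hX : X.PosSemidef) :
    (Φ X).PosSemidef :=
  posSemidef_map_of_choiMatrix (isCompletelyPositive_iff.1 h) hX

theorem IsCompletelyPositive.of_kraus [Fintype p] [DecidableEq p] [Fintype q] {ι : Type*}
    [Fintype ι] {Φ : SuperOp p q} (A : ι → Matrix q p ℂ)
    (hA : ∀ X, Φ X = ∑ i, A i * X * (A i)ᴴ) : IsCompletelyPositive Φ :=
  isCompletelyPositive_iff.2 (choiMatrix_posSemidef_of_kraus A hA)

theorem IsCompletelyPositive.id [Fintype p] [DecidableEq p] :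
    IsCompletelyPositive (LinearMap.id : SuperOp p p) :=
  isCompletelyPositive_iff.2 choiMatrix_id_posSemidef

theorem IsCompletelyPositive.mapTensor [Fintype p] [DecidableEq p] [Fintype q]
    [Fintype r] [DecidableEq r] [Fintype s] {Φ : SuperOp p q} {Ψ : SuperOp r s}
    (hΦ : IsCompletelyPositive Φ) (hΨ : IsCompletelyPositive Ψ) :
    IsCompletelyPositive (mapTensor Φ Ψ) := by
  rw [isCompletelyPositive_iff] at *
  rw [choiMatrix_mapTensor]
  exact (hΦ.kronecker hΨ).submatrix _

theorem IsCompletelyPositive.comp [Fintype p] [DecidableEq p] [Fintype q] [DecidableEq q]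
    [Fintype r] {Φ : SuperOp p q} {Ψ : SuperOp q r}
    (hΨ : IsCompletelyPositive Ψ) (hΦ : IsCompletelyPositive Φ) :
    IsCompletelyPositive (Ψ ∘ₗ Φ) := by
  intro k X hX
  have := hΨ k _ (hΦ k X hX)
  rwa [← LinearMap.comp_apply, mapTensor_comp, LinearMap.comp_id] at this

theorem IsCompletelyPositive.relabel [Fintype p] [DecidableEq p] [Fintype q] [DecidableEq q]
    (e : p ≃ q) : IsCompletelyPositive (relabel e) := by
  refine IsCompletelyPositive.of_kraus
    (fun _ : Unit => Matrix.of fun i j => if e.symm i = j then (1 : ℂ) else 0) fun X => ?_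
  ext i j
  simp [Matrix.mul_apply]

/-- Conjugating a completely positive map by transpositions preserves complete positivity. -/
theorem IsCompletelyPositive.transpose_conj [Fintype p] [DecidableEq p] [Fintype q]
    {Φ : SuperOp p q} (h : IsCompletelyPositive Φ) :
    IsCompletelyPositive (transposeMap q ∘ₗ Φ ∘ₗ transposeMap p) := by
  rw [isCompletelyPositive_iff] at *
  have : choiMatrix (transposeMap q ∘ₗ Φ ∘ₗ transposeMap p) = (choiMatrix Φ)ᵀ := by
    ext x y
    simp [choiMatrix]
  rw [this]
  exact h.transpose

theorem IsChannel.id [Fintype p] [DecidableEq p] : IsChannel (LinearMap.id : SuperOp p p) :=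
  ⟨.id, fun _ => rfl⟩

theorem IsChannel.comp [Fintype p] [DecidableEq p] [Fintype q] [DecidableEq q]
    [Fintype r] {Φ : SuperOp p q} {Ψ : SuperOp q r}
    (hΨ : IsChannel Ψ) (hΦ : IsChannel Φ) : IsChannel (Ψ ∘ₗ Φ) :=
  ⟨hΨ.1.comp hΦ.1, fun X => by rw [LinearMap.comp_apply, hΨ.2, hΦ.2]⟩

theorem IsChannel.mapTensor [Fintype p] [DecidableEq p] [Fintype q]
    [Fintype r] [DecidableEq r] [Fintype s] {Φ : SuperOp p q} {Ψ : SuperOp r s}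
    (hΦ : IsChannel Φ) (hΨ : IsChannel Ψ) : IsChannel (mapTensor Φ Ψ) := by
  refine ⟨hΦ.1.mapTensor hΨ.1, fun X => ?_⟩
  have : Matrix.traceLinearMap (q × s) ℂ ℂ ∘ₗ PPTCode.mapTensor Φ Ψ =
      Matrix.traceLinearMap (p × r) ℂ ℂ :=
    kron_ext fun A B => by simp [Matrix.trace_kronecker, hΦ.2, hΨ.2]
  exact LinearMap.congr_fun this X

theorem IsChannel.relabel [Fintype p] [DecidableEq p] [Fintype q] [DecidableEq q]
    (e : p ≃ q) : IsChannel (relabel e) := by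
  refine ⟨.relabel e, fun X => ?_⟩
  simp only [Matrix.trace, Matrix.diag, relabel_apply]
  exact Equiv.sum_comp e.symm fun i => X i i

theorem IsChannel.map_isState [Fintype p] [DecidableEq p] [Fintype q] {Φ : SuperOp p q}
    (h : IsChannel Φ) {ρ : Matrix p p ℂ} (hρ : IsState ρ) : IsState (Φ ρ) :=
  ⟨h.1.map_posSemidef hρ.1, by rw [h.2, hρ.2]⟩

/-- Preparing a system in a fixed state next to the given one. -/
def prepare (ω : Matrix q q ℂ) : SuperOp p (q × p) where
  toFun X := ω ⊗ₖ X
  map_add' X Y := Matrix.kronecker_add ω X Y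
  map_smul' c X := Matrix.kronecker_smul c ω X

@[simp]
theorem prepare_apply (ω : Matrix q q ℂ) (X : Matrix p p ℂ) : prepare ω X = ω ⊗ₖ X := rfl

theorem IsChannel.prepare [Fintype p] [DecidableEq p] [Fintype q] {ω : Matrix q q ℂ}
    (h : IsState ω) : IsChannel (prepare ω : SuperOp p (q × p)) := by
  refine ⟨isCompletelyPositive_iff.2 ?_, fun X => ?_⟩
  · have : choiMatrix (PPTCode.prepare ω : SuperOp p (q × p)) =
        (ω ⊗ₖ choiMatrix (LinearMap.id : SuperOp p p)).submatrix
          (Equiv.prodAssoc q p p) (Equiv.prodAssoc q p p) := by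
      ext x y
      simp [choiMatrix]
    rw [this]
    exact (h.1.kronecker choiMatrix_id_posSemidef).submatrix _
  · rw [prepare_apply, Matrix.trace_kronecker, h.2, one_mul]

end Calculus

/-! ### PPT preservation as complete positivity of the transposed map. -/

section PPTPreserving

variable {p q r s : Type*} {α β α' β' : Type*}

theorem kron_ext₃ [Finite p] [Finite q] [Finite r] {M : Type*} [AddCommMonoid M]
    [Module ℂ M] {f g : Matrix ((p × q) × r) ((p × q) × r) ℂ →ₗ[ℂ] M}
    (h : ∀ (A : Matrix p p ℂ) (B : Matrix q q ℂ) (C : Matrix r r ℂ),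
      f ((A ⊗ₖ B) ⊗ₖ C) = g ((A ⊗ₖ B) ⊗ₖ C)) : f = g := by
  refine kron_ext fun V C => ?_
  let L : Matrix (p × q) (p × q) ℂ →ₗ[ℂ] Matrix ((p × q) × r) ((p × q) × r) ℂ :=
    relabel (Equiv.prodComm r (p × q)) ∘ₗ prepare C
  have hL : ∀ V, L V = V ⊗ₖ C := fun V => by simp [L]
  have : f ∘ₗ L = g ∘ₗ L := kron_ext fun A B => by simp [L, h]
  simpa [hL] using LinearMap.congr_fun this V

theorem kron_ext₄ [Finite p] [Finite q] [Finite r] [Finite s] {M : Type*} [AddCommMonoid M]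
    [Module ℂ M] {f g : Matrix ((p × q) × (r × s)) ((p × q) × (r × s)) ℂ →ₗ[ℂ] M}
    (h : ∀ (A : Matrix p p ℂ) (B : Matrix q q ℂ) (C : Matrix r r ℂ) (D : Matrix s s ℂ),
      f ((A ⊗ₖ B) ⊗ₖ (C ⊗ₖ D)) = g ((A ⊗ₖ B) ⊗ₖ (C ⊗ₖ D))) : f = g := by
  refine kron_ext fun V W => ?_
  have : f ∘ₗ prepare V = g ∘ₗ prepare V := kron_ext fun C D => by
    let L : Matrix (p × q) (p × q) ℂ →ₗ[ℂ] Matrix ((p × q) × (r × s)) ((p × q) × (r × s)) ℂ :=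
      relabel (Equiv.prodComm (r × s) (p × q)) ∘ₗ prepare (C ⊗ₖ D)
    have hL : ∀ V, L V = V ⊗ₖ (C ⊗ₖ D) := fun V => by simp [L]
    have : f ∘ₗ L = g ∘ₗ L := kron_ext fun A B => by simp [L, h]
    simpa [hL] using LinearMap.congr_fun this V
  simpa using LinearMap.congr_fun this W

theorem isState_maxEnt [Fintype p] [DecidableEq p] [Nonempty p] : IsState (maxEnt p) := by
  have hc : (0 : ℝ) ≤ ((Fintype.card p : ℝ))⁻¹ := by positivity
  have hs : ((Fintype.card p : ℂ))⁻¹ =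
      (Real.sqrt ((Fintype.card p : ℝ)⁻¹) : ℂ) * (Real.sqrt ((Fintype.card p : ℝ)⁻¹) : ℂ) := by
    rw [← Complex.ofReal_mul, Real.mul_self_sqrt hc]
    simp
  constructor
  · refine posSemidef_of_gram (fun (_ : Unit) x =>
      if x.1 = x.2 then (Real.sqrt ((Fintype.card p : ℝ)⁻¹) : ℂ) else 0) fun x y => ?_
    by_cases h₁ : x.1 = x.2 <;> by_cases h₂ : y.1 = y.2 <;>
      simp [maxEnt, h₁, h₂, hs, Complex.conj_ofReal]
  · have h0 : (Fintype.card p : ℂ) ≠ 0 := by simp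
    simp [Matrix.trace, maxEnt, Fintype.sum_prod_type, h0]

theorem IsState.kron [Fintype p] [Fintype q] {ρ : Matrix p p ℂ} {σ : Matrix q q ℂ}
    (hρ : IsState ρ) (hσ : IsState σ) : IsState (ρ ⊗ₖ σ) := by
  classical
  exact ⟨hρ.1.kronecker hσ.1, by rw [Matrix.trace_kronecker, hρ.2, hσ.2, mul_one]⟩

/-- Conjugation of a bipartite map by the partial transposition. -/
def transposeConj (Z : SuperOp (α × β) (α' × β')) : SuperOp (α × β) (α' × β') :=
  partialTransposeMap α' β' ∘ₗ Z ∘ₗ partialTransposeMap α β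

/-- Transposing Bob's system and ancilla is a tensor product of two partial transpositions. The one
on the ancillas passes through the identity; the one on the systems conjugates `Z`. -/
theorem partialTranspose_extend [Fintype α] [DecidableEq α] [Fintype β] [DecidableEq β]
    (Z : SuperOp (α × β) (α' × β')) (m n : ℕ)
    (ρ : Matrix ((α × Fin m) × (β × Fin n)) ((α × Fin m) × (β × Fin n)) ℂ) :
    partialTranspose (extend Z m n ρ) =
      extend (transposeConj Z) m n (partialTranspose ρ) := by
  have h₁ : mapTensor (partialTransposeMap α β) (partialTransposeMap (Fin m) (Fin n)) ∘ₗ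
        relabel (Equiv.prodProdProdComm α (Fin m) β (Fin n)) =
      relabel (Equiv.prodProdProdComm α (Fin m) β (Fin n)) ∘ₗ
        partialTransposeMap (α × Fin m) (β × Fin n) :=
    kron_ext₄ fun A B C D => by
      simp [← Matrix.kroneckerMap_transpose]
  have h₂ : partialTransposeMap (α' × Fin m) (β' × Fin n) ∘ₗ
        relabel (Equiv.prodProdProdComm α' β' (Fin m) (Fin n)) ∘ₗ
        mapTensor Z (LinearMap.id : SuperOp (Fin m × Fin n) (Fin m × Fin n)) =
      relabel (Equiv.prodProdProdComm α' β' (Fin m) (Fin n)) ∘ₗ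
        mapTensor (transposeConj Z) LinearMap.id ∘ₗ
        mapTensor (partialTransposeMap α β) (partialTransposeMap (Fin m) (Fin n)) :=
    kron_ext fun V W => by
      simp only [LinearMap.comp_apply, mapTensor_kron, LinearMap.id_apply, transposeConj,
        partialTransposeMap_partialTransposeMap]
      rfl
  have h₃ := LinearMap.congr_fun h₁ ρ
  have h₄ := LinearMap.congr_fun h₂
    (relabel (Equiv.prodProdProdComm α (Fin m) β (Fin n)) ρ)
  simp only [LinearMap.comp_apply] at h₃ h₄
  rw [h₃] at h₄
  exact h₄

theorem isPPTPreserving_of_transposeConj [Fintype α] [DecidableEq α] [Fintype β]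
    [DecidableEq β] [Fintype α'] [Fintype β']
    {Z : SuperOp (α × β) (α' × β')} (h : IsCompletelyPositive (transposeConj Z)) :
    IsPPTPreserving Z := by
  classical
  intro m n ρ _ hρ
  rw [IsPPT, partialTranspose_extend]
  exact (((IsCompletelyPositive.relabel _).comp (h.mapTensor .id)).comp (.relabel _)).map_posSemidef
    hρ

theorem partialTransposeMap_single {p q : Type*} [DecidableEq p] [DecidableEq q]
    (x y : p) (z w : q) :
    partialTransposeMap p q (Matrix.single (x, z) (y, w) 1) = Matrix.single (x, w) (y, z) 1 := by
  have := partialTransposeMap_kron (Matrix.single x y (1 : ℂ)) (Matrix.single z w 1)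
  simpa [Matrix.single_kronecker_single] using this

theorem mapTensor_id_graph [Fintype p] [DecidableEq p] [Fintype s] [DecidableEq s]
    (Φ : SuperOp p q) (e : p ≃ s) (i j : q) (k l : p) :
    mapTensor Φ (LinearMap.id : SuperOp s s)
        (Matrix.of fun x y => if e x.1 = x.2 ∧ e y.1 = y.2 then 1 else 0) (i, e k) (j, e l) =
      Φ (Matrix.single k l 1) i j := by
  simp [mapTensor_apply, Fintype.sum_prod_type, Matrix.single_apply, ite_and]

/-- One test state suffices: each party's system maximally entangled with that party's own ancilla.
It is a product across the cut, hence PPT, and the partial transpose of its image is the Choi matrix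
of the transposed map up to normalisation and reordering. -/
theorem IsPPTPreserving.transposeConj [Fintype α] [DecidableEq α] [Nonempty α]
    [Fintype β] [DecidableEq β] [Nonempty β] [Fintype α'] [Fintype β']
    {Z : SuperOp (α × β) (α' × β')} (h : IsPPTPreserving Z) :
    IsCompletelyPositive (transposeConj Z) := by
  let e := Fintype.equivFin α
  let f := Fintype.equivFin β
  let g := (Equiv.prodCongr (Equiv.prodCongr (Equiv.refl α) e)
    (Equiv.prodCongr (Equiv.refl β) f))
  let ρ := relabel g (maxEnt α ⊗ₖ maxEnt β)
  have hρ : IsState ρ := (IsChannel.relabel g).map_isState (isState_maxEnt.kron isState_maxEnt)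
  have hρ' : IsPPT ρ := by
    have : partialTranspose ρ = relabel g (maxEnt α ⊗ₖ (maxEnt β)ᵀ) := by
      ext x y
      simp [partialTranspose, ρ, g]
    rw [IsPPT, this]
    exact (IsCompletelyPositive.relabel g).map_posSemidef
      ((isState_maxEnt (p := α)).1.kronecker (isState_maxEnt (p := β)).1.transpose)
  have hP := (h _ _ ρ hρ hρ').submatrix
    (fun x : (α' × β') × (α × β) => ((x.1.1, e x.2.1), (x.1.2, f x.2.2)))
  have hc : (0 : ℂ) ≤ (Fintype.card α : ℂ) * (Fintype.card β : ℂ) := by positivity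
  have hgraph : relabel (Equiv.prodProdProdComm α _ β _) ρ =
      ((Fintype.card α : ℂ) * (Fintype.card β : ℂ))⁻¹ • Matrix.of fun x y =>
        if Equiv.prodCongr e f x.1 = x.2 ∧ Equiv.prodCongr e f y.1 = y.2 then 1 else 0 := by
    ext ⟨⟨i, j⟩, k, l⟩ ⟨⟨i', j'⟩, k', l'⟩
    simp only [relabel_apply, ρ, g, maxEnt, Matrix.kroneckerMap_apply, Matrix.of_apply,
      Matrix.smul_apply, Equiv.prodProdProdComm_symm, Equiv.prodProdProdComm_apply,
      Equiv.prodCongr_symm, Equiv.prodCongr_apply, Prod.map_apply, Equiv.refl_symm,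
      Equiv.refl_apply, Prod.mk.injEq, Equiv.eq_symm_apply, smul_eq_mul, mul_inv]
    by_cases h₁ : e i = k <;> by_cases h₂ : e i' = k' <;> by_cases h₃ : f j = l <;>
      by_cases h₄ : f j' = l' <;> simp [h₁, h₂, h₃, h₄]
  have hE : ∀ i j k l i' j' k' l', extend Z _ _ ρ ((i, e k), (j, f l)) ((i', e k'), (j', f l')) =
      ((Fintype.card α : ℂ) * (Fintype.card β : ℂ))⁻¹ *
        Z (Matrix.single (k, l) (k', l') 1) (i, j) (i', j') := by
    intro i j k l i' j' k' l'
    rw [← mapTensor_id_graph Z (Equiv.prodCongr e f)]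
    simp only [extend, LinearMap.comp_apply, relabel_apply, hgraph, map_smul,
      Matrix.smul_apply, smul_eq_mul]
    rfl
  rw [isCompletelyPositive_iff]
  convert hP.smul hc using 1
  have h₁ : (Fintype.card α : ℂ) ≠ 0 := by simp
  have h₂ : (Fintype.card β : ℂ) ≠ 0 := by simp
  ext ⟨⟨i, j⟩, k, l⟩ ⟨⟨i', j'⟩, k', l'⟩
  -- Bob's output indices `j`, `j'` and input indices `l`, `l'` are exchanged by the two partial
  -- transpositions.
  have hx := hE i j' k l' i' j k' l
  rw [Matrix.smul_apply, Matrix.submatrix_apply]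
  change PPTCode.transposeConj Z (Matrix.single (k, l) (k', l') 1) (i, j) (i', j') =
    _ • extend Z _ _ ρ ((i, e k), (j', f l')) ((i', e k'), (j, f l))
  rw [hx, PPTCode.transposeConj, LinearMap.comp_apply, LinearMap.comp_apply,
    partialTransposeMap_single, smul_eq_mul,
    mul_inv_cancel_left₀ (mul_ne_zero h₁ h₂)]
  rfl

end PPTPreserving

/-! ### PPT-preserving codes in terms of their decoders. -/

section Codes

variable {a b : Type*} [Fintype a] [DecidableEq a] [Fintype b] [DecidableEq b]

/-- Conjugation of a decoder by the transpositions of Bob's input and output. -/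
def decoderTranspose {p q r : Type*} (D : SuperOp (p × q) r) : SuperOp (p × q) r :=
  transposeMap r ∘ₗ D ∘ₗ partialTransposeMap p q

/-- Bob's input passes the encoder and the side channel untouched, so its transposition can be moved
up to the decoder. The received system `R` is internal to the code and is never transposed. -/
theorem transposeConj_bipartite {K : ℕ} (C : ForwardCode a b K) :
    transposeConj C.bipartite =
      mapTensor (LinearMap.id : SuperOp a a) (decoderTranspose C.dec) ∘ₗ
        mapTensor (LinearMap.id : SuperOp a a)
          (mapTensor C.side (LinearMap.id : SuperOp b b)) ∘ₗ
        relabel (Equiv.prodAssoc a (Fin C.dimQ) b) ∘ₗ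
        mapTensor C.enc (LinearMap.id : SuperOp b b) := by
  have h₁ : mapTensor C.enc (LinearMap.id : SuperOp b b) ∘ₗ partialTransposeMap (Fin K) b =
      partialTransposeMap (a × Fin C.dimQ) b ∘ₗ mapTensor C.enc LinearMap.id :=
    kron_ext fun A B => by simp
  have h₂ : partialTransposeMap a (Fin K) ∘ₗ
      mapTensor (LinearMap.id : SuperOp a a) C.dec ∘ₗ
        mapTensor (LinearMap.id : SuperOp a a)
          (mapTensor C.side (LinearMap.id : SuperOp b b)) ∘ₗ
        relabel (Equiv.prodAssoc a (Fin C.dimQ) b) ∘ₗ partialTransposeMap (a × Fin C.dimQ) b =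
      mapTensor (LinearMap.id : SuperOp a a) (decoderTranspose C.dec) ∘ₗ
        mapTensor (LinearMap.id : SuperOp a a)
          (mapTensor C.side (LinearMap.id : SuperOp b b)) ∘ₗ
        relabel (Equiv.prodAssoc a (Fin C.dimQ) b) :=
    kron_ext₃ fun A B D => by simp [decoderTranspose]
  simp only [transposeConj, ForwardCode.bipartite, LinearMap.comp_assoc, h₁]
  simp only [← LinearMap.comp_assoc] at h₂ ⊢
  rw [h₂]

theorem ForwardCode.isPPTPreserving {K : ℕ} (C : ForwardCode a b K)
    (h : IsCompletelyPositive (decoderTranspose C.dec)) : IsPPTPreserving C.bipartite := by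
  refine isPPTPreserving_of_transposeConj ?_
  rw [transposeConj_bipartite]
  exact (IsCompletelyPositive.id.mapTensor h).comp
    ((IsCompletelyPositive.id.mapTensor (C.side_isChannel.1.mapTensor .id)).comp
      ((IsCompletelyPositive.relabel _).comp (C.enc_isChannel.1.mapTensor .id)))

end Codes

/-! ### Entanglement fidelity and channel fidelity. -/

section Fidelity

variable {p q : Type*} [Fintype p] [DecidableEq p]

theorem maxEnt_conjTranspose : (maxEnt p)ᴴ = maxEnt p := by
  ext x y
  by_cases h₁ : x.1 = x.2 <;> by_cases h₂ : y.1 = y.2 <;> simp [maxEnt, h₁, h₂]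

theorem maxEnt_mul_self [Nonempty p] : maxEnt p * maxEnt p = maxEnt p := by
  have h0 : (Fintype.card p : ℂ) ≠ 0 := by simp
  ext x y
  by_cases h₁ : x.1 = x.2 <;> by_cases h₂ : y.1 = y.2 <;>
    simp [maxEnt, h₁, h₂, Matrix.mul_apply, Fintype.sum_prod_type, h0]

theorem relabel_prodComm_maxEnt : relabel (Equiv.prodComm p p) (maxEnt p) = maxEnt p := by
  ext x y
  simp [maxEnt, eq_comm]

/-- As `φ` is a projection, `Tr φσ = Tr φσφ`. The upper bound applies the same argument to the
projection `1 - φ`. -/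
theorem entFidelity_nonneg [Nonempty p] {σ : Matrix (p × p) (p × p) ℂ} (h : IsState σ) :
    0 ≤ entFidelity σ := by
  have := (h.1.mul_mul_conjTranspose_same (maxEnt p)).trace_nonneg
  rw [Matrix.trace_mul_cycle, maxEnt_conjTranspose, maxEnt_mul_self] at this
  exact (Complex.le_def.1 this).1

theorem entFidelity_le_one [Nonempty p] {σ : Matrix (p × p) (p × p) ℂ} (h : IsState σ) :
    entFidelity σ ≤ 1 := by
  have := (h.1.mul_mul_conjTranspose_same (1 - maxEnt p)).trace_nonneg
  have hsq : (1 - maxEnt p) * (1 - maxEnt p) = 1 - maxEnt p := by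
    simp [sub_mul, mul_sub, maxEnt_mul_self]
  rw [Matrix.trace_mul_cycle, Matrix.conjTranspose_sub, maxEnt_conjTranspose,
    Matrix.conjTranspose_one, hsq, sub_mul, one_mul, Matrix.trace_sub, h.2] at this
  have := (Complex.le_def.1 this).1
  simp only [Complex.zero_re, Complex.sub_re, Complex.one_re, sub_nonneg] at this
  exact this

theorem entFidelity_relabel_prodComm (σ : Matrix (p × p) (p × p) ℂ) :
    entFidelity (relabel (Equiv.prodComm p p) σ) = entFidelity σ := by
  simp [entFidelity, Matrix.trace, Matrix.mul_apply, maxEnt, Fintype.sum_prod_type, ite_and]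

theorem entFidelity_eq (σ : Matrix (p × p) (p × p) ℂ) :
    entFidelity σ = ((Fintype.card p : ℂ)⁻¹ * ∑ x, ∑ y, σ (x, x) (y, y)).re := by
  rw [entFidelity]
  congr 1
  simp only [Matrix.trace, Matrix.diag, Matrix.mul_apply, maxEnt, Matrix.of_apply,
    Fintype.sum_prod_type, ite_and, ite_mul, zero_mul, Finset.mul_sum]
  simp
  exact Finset.sum_comm

theorem channelFidelity_eq (M : SuperOp p p) :
    channelFidelity M =
      ((Fintype.card p : ℂ)⁻¹ * ((Fintype.card p : ℂ)⁻¹ *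
        ∑ x, ∑ y, M (Matrix.single x y 1) x y)).re := by
  rw [channelFidelity, entFidelity_eq]
  congr 2
  simp [mapTensor_apply, maxEnt, Fintype.sum_prod_type, ite_and, Matrix.single_apply,
    Finset.mul_sum, mul_comm]

theorem channelFidelity_eq_choiState (M : SuperOp p p) :
    channelFidelity M = entFidelity (choiState M) := by
  have : mapTensor M (LinearMap.id : SuperOp p p) ∘ₗ relabel (Equiv.prodComm p p) =
      relabel (Equiv.prodComm p p) ∘ₗ mapTensor LinearMap.id M := kron_ext fun A B => by simp
  have := LinearMap.congr_fun this (maxEnt p)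
  simp only [LinearMap.comp_apply, relabel_prodComm_maxEnt] at this
  rw [channelFidelity, this, entFidelity_relabel_prodComm, choiState]

end Fidelity

/-! ### A unitary operator basis in every dimension. -/

section Weyl

/-- The Weyl operators on `ℂ^K`: products of cyclic shifts and clock matrices. -/
noncomputable def weyl (K : ℕ) [NeZero K] (w : ZMod K × ZMod K) :
    Matrix (ZMod K) (ZMod K) ℂ :=
  Matrix.of fun i j => if i = j + w.1 then ZMod.stdAddChar (w.2 * j) else 0

theorem stdAddChar_mul_star (K : ℕ) [NeZero K] (x y : ZMod K) :
    ZMod.stdAddChar x * star (ZMod.stdAddChar y : ℂ) = ZMod.stdAddChar (x - y) := by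
  rw [sub_eq_add_neg, AddChar.map_add_eq_mul, AddChar.map_neg_eq_conj]
  rfl

theorem weyl_conjTranspose_mul_self (K : ℕ) [NeZero K] (w : ZMod K × ZMod K) :
    (weyl K w)ᴴ * weyl K w = 1 := by
  ext x y
  simp only [weyl, Matrix.mul_apply, Matrix.conjTranspose_apply, Matrix.of_apply, mul_ite,
    mul_zero, Finset.sum_ite_eq', Finset.mem_univ, if_true, add_left_inj, Matrix.one_apply]
  by_cases h : x = y
  · subst h
    rw [mul_comm]
    simpa using stdAddChar_mul_star K (w.2 * x) (w.2 * x)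
  · simp [h, Ne.symm h]

/-- For a fixed shift, the sum over clock exponents is a character sum, which vanishes unless `j =
l`. In that case only the shift `i - j` contributes, and it forces `i = k`. -/
theorem sum_weyl_mul_star_weyl (K : ℕ) [NeZero K] (i j k l : ZMod K) :
    ∑ w, weyl K w i j * star (weyl K w k l) = if i = k ∧ j = l then (K : ℂ) else 0 := by
  have hs : ∀ s, (∑ t, weyl K (s, t) i j * star (weyl K (s, t) k l)) =
      if i = j + s ∧ k = l + s then (if j = l then (K : ℂ) else 0) else 0 := by
    intro s
    by_cases h₁ : i = j + s <;> by_cases h₂ : k = l + s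
    · have hsum := AddChar.sum_mulShift (R' := ℂ) (j - l) (ZMod.isPrimitive_stdAddChar K)
      simp only [weyl, Matrix.of_apply, h₁, h₂, if_true, stdAddChar_mul_star, ← mul_sub, hsum,
        sub_eq_zero, ZMod.card, and_self]
      split_ifs <;> simp
    all_goals simp [weyl, h₁, h₂]
  rw [Fintype.sum_prod_type]
  simp only [hs]
  by_cases h : j = l
  · subst h
    have : ∀ s, (i = j + s ∧ k = j + s) ↔ (s = i - j ∧ i = k) := fun s => by
      constructor
      · rintro ⟨rfl, rfl⟩; simp
      · rintro ⟨rfl, rfl⟩; simp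
    simp only [this]
    by_cases hik : i = k <;> simp [hik]
  · simp [h]

/-- Every nonempty finite system carries a unitary operator basis. -/
theorem exists_unitary_basis (p : Type*) [Fintype p] [DecidableEq p] [Nonempty p] :
    ∃ (m : ℕ) (W : Fin m → Matrix p p ℂ), (∀ w, (W w)ᴴ * W w = 1) ∧
      ∀ i j k l, ∑ w, W w i j * star (W w k l) =
        if i = k ∧ j = l then (Fintype.card p : ℂ) else 0 := by
  have : NeZero (Fintype.card p) := ⟨Fintype.card_ne_zero⟩
  let e : p ≃ ZMod (Fintype.card p) := Fintype.equivOfCardEq (ZMod.card _).symm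
  let f := (Fintype.equivFin (ZMod (Fintype.card p) × ZMod (Fintype.card p))).symm
  refine ⟨_, fun w => (weyl _ (f w)).submatrix e e, fun w => ?_, fun i j k l => ?_⟩
  · rw [Matrix.conjTranspose_submatrix, Matrix.submatrix_mul_equiv, weyl_conjTranspose_mul_self,
      Matrix.submatrix_one_equiv]
  · simp only [Matrix.submatrix_apply]
    rw [Equiv.sum_comp f fun w => weyl _ w (e i) (e j) * star (weyl _ w (e k) (e l)),
      sum_weyl_mul_star_weyl]
    simp

end Weyl

/-! ### Channels given by Kraus operators. -/

section Kraus

variable {p q ι : Type*} [Fintype p] [Fintype ι]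

/-- The map with the given Kraus operators. -/
def krausMap (A : ι → Matrix q p ℂ) : SuperOp p q where
  toFun X := ∑ i, A i * X * (A i)ᴴ
  map_add' X Y := by simp [Matrix.mul_add, Matrix.add_mul, Finset.sum_add_distrib]
  map_smul' c X := by simp [Finset.smul_sum]

theorem krausMap_apply (A : ι → Matrix q p ℂ) (X : Matrix p p ℂ) :
    krausMap A X = ∑ i, A i * X * (A i)ᴴ := rfl

theorem krausMap_single [DecidableEq p] (A : ι → Matrix q p ℂ) (x y : p) (i j : q) :
    krausMap A (Matrix.single x y 1) i j = ∑ w, A w i x * star (A w j y) := by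
  simp [krausMap_apply, Matrix.sum_apply, Matrix.mul_apply, Matrix.single_apply, ite_and]

theorem isChannel_krausMap [DecidableEq p] [Fintype q] (A : ι → Matrix q p ℂ)
    (h : ∑ i, (A i)ᴴ * A i = 1) : IsChannel (krausMap A) := by
  refine ⟨.of_kraus A fun X => rfl, fun X => ?_⟩
  rw [krausMap_apply, Matrix.trace_sum]
  have : ∀ i, (A i * X * (A i)ᴴ).trace = ((A i)ᴴ * A i * X).trace := fun i =>
    Matrix.trace_mul_cycle _ _ _
  rw [Finset.sum_congr rfl fun i _ => this i, ← Matrix.trace_sum, ← Finset.sum_mul, h, one_mul]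

end Kraus

/-! ### Teleportation through an arbitrary pair. -/

section Teleportation

variable {p : Type*} [Fintype p] [DecidableEq p]

/-- The Kraus operators of the teleportation of the last factor through a pair `p × p`: a
measurement of the first and last factors in the basis of maximally entangled vectors
given by `W`, followed by the correction `W w` of the second factor. -/
noncomputable def teleportKraus {m : ℕ} (W : Fin m → Matrix p p ℂ) (w : Fin m) :
    Matrix p ((p × p) × p) ℂ :=
  Matrix.of fun j x =>
    (Real.sqrt ((Fintype.card p : ℝ)⁻¹) : ℂ) * W w j x.1.2 * star (W w x.2 x.1.1)

theorem sqrt_inv_card_mul_self (p : Type*) [Fintype p] :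
    (Real.sqrt ((Fintype.card p : ℝ)⁻¹) : ℂ) * (Real.sqrt ((Fintype.card p : ℝ)⁻¹) : ℂ) =
      (Fintype.card p : ℂ)⁻¹ := by
  rw [← Complex.ofReal_mul, Real.mul_self_sqrt (by positivity)]
  simp

variable {m : ℕ} {W : Fin m → Matrix p p ℂ}

/-- Unitarity of the corrections gives the identity on the second factor; completeness of the basis
resolves the identity on the two measured factors. -/
theorem isChannel_teleport [Nonempty p] (hW : ∀ w, (W w)ᴴ * W w = 1)
    (hW' : ∀ i j k l, ∑ w, W w i j * star (W w k l) =
      if i = k ∧ j = l then (Fintype.card p : ℂ) else 0) :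
    IsChannel (krausMap (teleportKraus W)) := by
  have h0 : (Fintype.card p : ℂ) ≠ 0 := by simp
  refine isChannel_krausMap _ ?_
  ext ⟨⟨x, y⟩, z⟩ ⟨⟨x', y'⟩, z'⟩
  have key : ∀ w, ((teleportKraus W w)ᴴ * teleportKraus W w) ((x, y), z) ((x', y'), z') =
      (Fintype.card p : ℂ)⁻¹ * (if y = y' then 1 else 0) *
        (W w z x * star (W w z' x')) := by
    intro w
    have h := congrFun (congrFun (hW w) y) y'
    rw [Matrix.mul_apply, Matrix.one_apply] at h
    rw [← h, ← sqrt_inv_card_mul_self p, Finset.mul_sum, Finset.sum_mul, Matrix.mul_apply]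
    refine Finset.sum_congr rfl fun j _ => ?_
    simp only [teleportKraus, Matrix.conjTranspose_apply, Matrix.of_apply, star_mul', RCLike.star_def,
      Complex.conj_ofReal, Complex.conj_conj]
    ring
  rw [Matrix.sum_apply]
  simp only [key]
  rw [← Finset.mul_sum, hW']
  simp only [Matrix.one_apply, Prod.mk.injEq]
  by_cases h₁ : y = y' <;> by_cases h₂ : z = z' <;> by_cases h₃ : x = x' <;>
    simp [h₁, h₂, h₃, h0]

/-- Tracing a Kraus operator over the teleported system leaves a multiple of `⟨φ|` that does not
depend on the outcome. All outcomes thus contribute equally, and their number is the square of the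
dimension. -/
theorem channelFidelity_teleport [Nonempty p] (hW : ∀ w, (W w)ᴴ * W w = 1)
    (hW' : ∀ i j k l, ∑ w, W w i j * star (W w k l) =
      if i = k ∧ j = l then (Fintype.card p : ℂ) else 0)
    (σ : Matrix (p × p) (p × p) ℂ) :
    channelFidelity (krausMap (teleportKraus W) ∘ₗ prepare σ) = entFidelity σ := by
  have h0 : (Fintype.card p : ℂ) ≠ 0 := by simp
  -- The size of the basis is found by computing the sum of `Tr (W w)ᴴ (W w)` once from unitarity
  -- and once from completeness.
  have hm : (m : ℂ) = (Fintype.card p : ℂ) * (Fintype.card p : ℂ) := by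
    have h₁ : ∑ w, ((W w)ᴴ * W w).trace = (m : ℂ) * (Fintype.card p : ℂ) := by
      simp [hW]
    have h₂ : ∑ w, ((W w)ᴴ * W w).trace =
        (Fintype.card p : ℂ) * (Fintype.card p : ℂ) * (Fintype.card p : ℂ) := by
      simp only [Matrix.trace, Matrix.diag, Matrix.mul_apply, Matrix.conjTranspose_apply]
      rw [Finset.sum_comm]
      have : ∀ i j, ∑ w, star (W w j i) * W w j i = (Fintype.card p : ℂ) := fun i j => by
        simpa [mul_comm] using hW' j i j i
      have h' : ∀ i, ∑ w, ∑ j, star (W w j i) * W w j i =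
          (Fintype.card p : ℂ) * (Fintype.card p : ℂ) := fun i => by
        rw [Finset.sum_comm]
        simp only [this]
        simp
      simp only [h']
      simp [mul_assoc]
    exact mul_right_cancel₀ h0 (h₁.symm.trans h₂)
  have hK : ∀ w x y, ∑ z, teleportKraus W w z ((x, y), z) =
      (Real.sqrt ((Fintype.card p : ℝ)⁻¹) : ℂ) * if x = y then 1 else 0 := by
    intro w x y
    have h := congrFun (congrFun (hW w) x) y
    rw [Matrix.mul_apply, Matrix.one_apply] at h
    rw [← h, Finset.mul_sum]
    refine Finset.sum_congr rfl fun z _ => ?_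
    simp only [teleportKraus, Matrix.of_apply, Matrix.conjTranspose_apply]
    ring
  have hM : ∑ z, ∑ z', (krausMap (teleportKraus W) ∘ₗ prepare σ) (Matrix.single z z' 1) z z' =
      ∑ w, ∑ u : p × p, ∑ v : p × p, (∑ z, teleportKraus W w z (u, z)) * σ u v *
        star (∑ z, teleportKraus W w z (v, z)) := by
    have h₁ : ∀ z z', (krausMap (teleportKraus W) ∘ₗ prepare σ) (Matrix.single z z' 1) z z' =
        ∑ w, ∑ u : p × p, ∑ v : p × p, teleportKraus W w z (u, z) * σ u v *
          star (teleportKraus W w z' (v, z')) := by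
      intro z z'
      simp only [LinearMap.comp_apply, prepare_apply, krausMap_apply, Matrix.sum_apply,
        Matrix.mul_apply, Matrix.conjTranspose_apply, Finset.sum_mul]
      refine Finset.sum_congr rfl fun w _ => ?_
      rw [Finset.sum_comm]
      simp [Fintype.sum_prod_type (α₁ := p × p) (α₂ := p), Matrix.single_apply, ite_and]
    simp only [h₁, star_sum, Finset.sum_mul, Finset.mul_sum]
    rw [Finset.sum_congr rfl fun z _ => Finset.sum_comm, Finset.sum_comm]
    refine Finset.sum_congr rfl fun w _ => ?_
    rw [Finset.sum_congr rfl fun z _ => Finset.sum_comm, Finset.sum_comm]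
    refine Finset.sum_congr rfl fun u _ => ?_
    rw [Finset.sum_congr rfl fun z _ => Finset.sum_comm, Finset.sum_comm]
    refine Finset.sum_congr rfl fun v _ => ?_
    rw [Finset.sum_comm]
  rw [channelFidelity_eq, entFidelity_eq, hM]
  congr 2
  have hw : ∀ w, ∑ u : p × p, ∑ v : p × p, (∑ z, teleportKraus W w z (u, z)) * σ u v *
      star (∑ z, teleportKraus W w z (v, z)) =
      (Fintype.card p : ℂ)⁻¹ * ∑ x, ∑ y, σ (x, x) (y, y) := by
    intro w
    rw [← sqrt_inv_card_mul_self p]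
    simp only [Fintype.sum_prod_type, hK, star_mul', RCLike.star_def, Complex.conj_ofReal,
      Finset.mul_sum]
    simp [mul_left_comm, mul_comm]
  simp only [hw, Finset.sum_const, Finset.card_univ, Fintype.card_fin, nsmul_eq_mul, hm]
  field_simp

/-- Transposing the second factor and the output replaces the correction `W w` by its complex
conjugate, which is again a Kraus form. -/
theorem isCompletelyPositive_teleport_transpose :
    IsCompletelyPositive (transposeMap p ∘ₗ krausMap (teleportKraus W) ∘ₗ
      mapTensor (partialTransposeMap p p) (LinearMap.id : SuperOp p p)) := by
  have hs : ∀ x y z x' y' z', mapTensor (partialTransposeMap p p) (LinearMap.id : SuperOp p p)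
      (Matrix.single ((x, y), z) ((x', y'), z') 1) =
      Matrix.single ((x, y'), z) ((x', y), z') 1 := by
    intro x y z x' y' z'
    have := mapTensor_kron (partialTransposeMap p p) (LinearMap.id : SuperOp p p)
      (Matrix.single x x' 1 ⊗ₖ Matrix.single y y' 1) (Matrix.single z z' 1)
    simpa [Matrix.single_kronecker_single, partialTransposeMap_single] using this
  rw [isCompletelyPositive_iff]
  refine posSemidef_of_gram (fun (w : Fin m) x =>
    (Real.sqrt ((Fintype.card p : ℝ)⁻¹) : ℂ) * star (W w x.1 x.2.1.2) *
      star (W w x.2.2 x.2.1.1)) ?_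
  rintro ⟨j, ⟨x, y⟩, z⟩ ⟨j', ⟨x', y'⟩, z'⟩
  rw [choiMatrix, Matrix.of_apply, LinearMap.comp_apply, LinearMap.comp_apply, hs,
    transposeMap_apply, Matrix.transpose_apply, krausMap_single]
  refine Finset.sum_congr rfl fun w _ => ?_
  simp only [teleportKraus, Matrix.of_apply, star_mul', RCLike.star_def,
    Complex.conj_ofReal, Complex.conj_conj]
  ring

end Teleportation

/-! ### Choi states. -/

section ChoiState

variable {p q : Type*} [Fintype p] [DecidableEq p]

theorem isState_choiState [Fintype q] [Nonempty p] {N : SuperOp p q} (hN : IsChannel N) :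
    IsState (choiState N) :=
  (IsChannel.id.mapTensor hN).map_isState isState_maxEnt

theorem choiState_apply (N : SuperOp p q) (x y : p × q) :
    choiState N x y = (Fintype.card p : ℂ)⁻¹ * N (Matrix.single x.1 y.1 1) x.2 y.2 := by
  simp [choiState, mapTensor_apply, maxEnt, Fintype.sum_prod_type, Matrix.single_apply,
    ite_and, mul_comm]

theorem IsChannel.nonempty [Fintype q] [Nonempty p] {N : SuperOp p q} (hN : IsChannel N) :
    Nonempty q := by
  by_contra h
  rw [not_nonempty_iff] at h
  have := hN.2 1
  simp at this
  exact Fintype.card_ne_zero (Nat.cast_eq_zero.mp this.symm)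

end ChoiState

/-! ### From distillation to codes. -/

section Distillation

variable {a b : Type*} [Fintype a] [DecidableEq a] [Fintype b] [DecidableEq b]

/-- Exchanging the last two of three tensor factors. -/
def swapRight (p q r : Type*) : (p × q) × r ≃ (p × r) × q where
  toFun x := ((x.1.1, x.2), x.1.2)
  invFun x := ((x.1.1, x.2), x.1.2)
  left_inv _ := rfl
  right_inv _ := rfl

@[simp]
theorem relabel_swapRight_kron {p q r : Type*} (A : Matrix p p ℂ) (B : Matrix q q ℂ)
    (C : Matrix r r ℂ) :
    relabel (swapRight p q r) ((A ⊗ₖ B) ⊗ₖ C) = (A ⊗ₖ C) ⊗ₖ B := by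
  ext i j
  simp [swapRight, mul_right_comm]

@[simp]
theorem relabel_relabel_symm {p q : Type*} (e : p ≃ q) (X : Matrix q q ℂ) :
    relabel e (relabel e.symm X) = X := by
  ext i j
  simp

/-- Bob applies `Y` to Alice's half of a state, received from her, and his own, and then the
teleporting operation `T` to the result and the system that Alice wants to send. -/
noncomputable def distillationDecoder {K : ℕ} (Y : SuperOp (a × b) (Fin K × Fin K))
    (T : SuperOp ((Fin K × Fin K) × Fin K) (Fin K)) :
    SuperOp (Fin (Fintype.card (a × Fin K)) × b) (Fin K) :=
  T ∘ₗ mapTensor Y LinearMap.id ∘ₗ relabel (swapRight a (Fin K) b) ∘ₗ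
    mapTensor (relabel (Fintype.equivFin (a × Fin K)).symm) LinearMap.id

/-- The code in which Alice sends half of a maximally entangled state through the channel and
everything else through the side channel, and Bob applies `Y` and then the
teleporting operation `T`. -/
noncomputable def distillationCode [Nonempty a] {K : ℕ} (Y : SuperOp (a × b) (Fin K × Fin K))
    (hY : IsChannel Y) (T : SuperOp ((Fin K × Fin K) × Fin K) (Fin K)) (hT : IsChannel T) :
    ForwardCode a b K where
  dimQ := Fintype.card (a × Fin K)
  dimR := Fintype.card (a × Fin K)
  enc := mapTensor LinearMap.id (relabel (Fintype.equivFin (a × Fin K))) ∘ₗ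
    relabel (Equiv.prodAssoc a a (Fin K)) ∘ₗ prepare (maxEnt a)
  side := LinearMap.id
  dec := distillationDecoder Y T
  enc_isChannel := (IsChannel.id.mapTensor (.relabel _)).comp
    ((IsChannel.relabel _).comp (.prepare isState_maxEnt))
  side_isChannel := .id
  dec_isChannel := hT.comp ((hY.mapTensor .id).comp
    ((IsChannel.relabel _).comp ((IsChannel.relabel _).mapTensor .id)))

/-- Two cancelling partial transpositions are inserted between `Y` and `T`, so that the transposed
decoder splits into the transposed teleportation and `transposeConj Y`. -/
theorem decoderTranspose_distillationDecoder {K : ℕ}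
    (Y : SuperOp (a × b) (Fin K × Fin K)) (T : SuperOp ((Fin K × Fin K) × Fin K) (Fin K)) :
    decoderTranspose (distillationDecoder Y T) =
      (transposeMap (Fin K) ∘ₗ T ∘ₗ
          mapTensor (partialTransposeMap (Fin K) (Fin K)) LinearMap.id) ∘ₗ
        mapTensor (transposeConj Y) LinearMap.id ∘ₗ relabel (swapRight a (Fin K) b) ∘ₗ
        mapTensor (relabel (Fintype.equivFin (a × Fin K)).symm) LinearMap.id := by
  have h : relabel (swapRight a (Fin K) b) ∘ₗ partialTransposeMap (a × Fin K) b =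
      mapTensor (partialTransposeMap a b) LinearMap.id ∘ₗ relabel (swapRight a (Fin K) b) :=
    kron_ext₃ fun A B C => by simp
  refine kron_ext fun Q B => ?_
  have h' := LinearMap.congr_fun h
    (relabel (Fintype.equivFin (a × Fin K)).symm Q ⊗ₖ B)
  have hcomp : ∀ V, mapTensor (partialTransposeMap (Fin K) (Fin K)) LinearMap.id
      (mapTensor (transposeConj Y) (LinearMap.id : SuperOp (Fin K) (Fin K)) V) =
      mapTensor Y LinearMap.id (mapTensor (partialTransposeMap a b) LinearMap.id V) := by
    intro V
    rw [← LinearMap.comp_apply, ← LinearMap.comp_apply, mapTensor_comp, mapTensor_comp]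
    rfl
  simp only [LinearMap.comp_apply, partialTransposeMap_kron] at h'
  simp [decoderTranspose, distillationDecoder, hcomp, h']

theorem apply_distillationCode [Nonempty a] {K : ℕ} (N : SuperOp a b)
    (Y : SuperOp (a × b) (Fin K × Fin K)) (hY : IsChannel Y)
    (T : SuperOp ((Fin K × Fin K) × Fin K) (Fin K)) (hT : IsChannel T) :
    (distillationCode Y hY T hT).apply N = T ∘ₗ prepare (Y (choiState N)) := by
  -- Stated for an arbitrary operator in place of `φ ⊗ X`, to be checked on products. The exchange
  -- of the two copies of `a` arises because the code sends the first half of `φ` and `choiState`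
  -- the second; symmetry of `φ` removes it.
  have h : distillationDecoder Y T ∘ₗ
        relabel (Equiv.prodComm b _) ∘ₗ mapTensor N LinearMap.id ∘ₗ
        mapTensor LinearMap.id (relabel (Fintype.equivFin (a × Fin K))) ∘ₗ
        relabel (Equiv.prodAssoc a a (Fin K)) =
      T ∘ₗ mapTensor (Y ∘ₗ mapTensor LinearMap.id N ∘ₗ relabel (Equiv.prodComm a a))
        LinearMap.id :=
    kron_ext₃ fun A B X => by
      have := relabel_relabel_symm (Fintype.equivFin (a × Fin K)).symm (B ⊗ₖ X)
      rw [Equiv.symm_symm] at this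
      simp [distillationDecoder, this]
  ext1 X
  have := LinearMap.congr_fun h (maxEnt a ⊗ₖ X)
  simp only [LinearMap.comp_apply, mapTensor_kron, relabel_prodComm_maxEnt] at this
  exact this

theorem codeAchieves_of_distills [Nonempty a] [Nonempty b] {N : SuperOp a b} {K : ℕ}
    (hK : 1 ≤ K) {f : ℝ} (h : Distills (choiState N) K f) : CodeAchieves N K f := by
  obtain ⟨Y, hY, hY', rfl⟩ := h
  have : Nonempty (Fin K) := ⟨⟨0, hK⟩⟩
  obtain ⟨m, W, hW, hW'⟩ := exists_unitary_basis (Fin K)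
  refine ⟨distillationCode Y hY _ (isChannel_teleport hW hW'), ?_, ?_⟩
  · refine ForwardCode.isPPTPreserving _ ?_
    have h := decoderTranspose_distillationDecoder Y (krausMap (teleportKraus W))
    change IsCompletelyPositive (decoderTranspose (distillationDecoder Y _))
    rw [h]
    exact isCompletelyPositive_teleport_transpose.comp
      ((hY'.transposeConj.mapTensor .id).comp ((IsCompletelyPositive.relabel _).comp
        ((IsCompletelyPositive.relabel _).mapTensor .id)))
  · rw [apply_distillationCode, channelFidelity_teleport hW hW']

theorem ForwardCode.isChannel_apply {K : ℕ} (C : ForwardCode a b K) {N : SuperOp a b}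
    (hN : IsChannel N) : IsChannel (C.apply N) :=
  C.dec_isChannel.comp ((IsChannel.relabel _).comp
    ((hN.mapTensor C.side_isChannel).comp C.enc_isChannel))

theorem CodeAchieves.mem_Icc {N : SuperOp a b} (hN : IsChannel N) {K : ℕ} (hK : 1 ≤ K) {f : ℝ}
    (h : CodeAchieves N K f) : f ∈ Set.Icc 0 1 := by
  obtain ⟨C, -, rfl⟩ := h
  have : Nonempty (Fin K) := ⟨⟨0, hK⟩⟩
  rw [channelFidelity_eq_choiState]
  have := isState_choiState (C.isChannel_apply hN)
  exact ⟨entFidelity_nonneg this, entFidelity_le_one this⟩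

theorem codeFidelity_nonneg {N : SuperOp a b} (hN : IsChannel N) {K : ℕ} (hK : 1 ≤ K) :
    0 ≤ codeFidelity N K :=
  Real.sSup_nonneg fun _ h => (h.mem_Icc hN hK).1

theorem codeFidelity_le_one {N : SuperOp a b} (hN : IsChannel N) {K : ℕ} (hK : 1 ≤ K) :
    codeFidelity N K ≤ 1 :=
  Real.sSup_le (fun _ h => (h.mem_Icc hN hK).2) zero_le_one

theorem distillFidelity_le_codeFidelity [Nonempty a] [Nonempty b] {N : SuperOp a b}
    (hN : IsChannel N) {K : ℕ} (hK : 1 ≤ K) :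
    distillFidelity (choiState N) K ≤ codeFidelity N K :=
  -- Real suprema need the bound by one to be meaningful, and nonnegativity covers the default value
  -- `0` of an empty supremum.
  Real.sSup_le (fun _ h => le_csSup ⟨1, fun _ h' => (CodeAchieves.mem_Icc hN hK h').2⟩
    (codeAchieves_of_distills hK h)) (codeFidelity_nonneg hN hK)

end Distillation

/-! ### Tensor powers and asymptotic rates. -/

section TensorPower

variable {p q r s : Type*}

/-- The tensor product of a family of operators. -/
def piKron {n : ℕ} (X : Fin n → Matrix p p ℂ) : Matrix (Fin n → p) (Fin n → p) ℂ :=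
  Matrix.of fun i j => ∏ t, X t (i t) (j t)

theorem piKron_single [DecidableEq p] {n : ℕ} (k l : Fin n → p) :
    piKron (fun t => Matrix.single (k t) (l t) (1 : ℂ)) = Matrix.single k l 1 := by
  ext i j
  simp only [piKron, Matrix.of_apply, Matrix.single_apply]
  rw [Finset.prod_ite_zero]
  simp [funext_iff, forall_and]

theorem piKron_ext [Finite p] {n : ℕ} {M : Type*} [AddCommMonoid M] [Module ℂ M]
    {f g : Matrix (Fin n → p) (Fin n → p) ℂ →ₗ[ℂ] M}
    (h : ∀ X : Fin n → Matrix p p ℂ, f (piKron X) = g (piKron X)) : f = g := by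
  classical
  refine superOp_ext fun k l => ?_
  rw [← piKron_single, h]

theorem trace_piKron [Fintype p] {n : ℕ} (X : Fin n → Matrix p p ℂ) :
    (piKron X).trace = ∏ t, (X t).trace := by
  classical
  simp [piKron, Matrix.trace, Finset.prod_univ_sum, Fintype.piFinset_univ]

theorem piKron_posSemidef [Finite p] {n : ℕ} {X : Fin n → Matrix p p ℂ}
    (h : ∀ t, (X t).PosSemidef) : (piKron X).PosSemidef := by
  classical
  choose m v hv using fun t => posSemidef_iff_exists_gram.1 (h t)
  refine posSemidef_of_gram (fun (i : ∀ t, Fin (m t)) x => ∏ t, v t (i t) (x t)) fun x y => ?_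
  simp [piKron, hv, Finset.prod_univ_sum, Fintype.piFinset_univ, Finset.prod_mul_distrib]

@[simp]
theorem tensorPow_piKron [Fintype p] [DecidableEq p] (Φ : SuperOp p q) (n : ℕ)
    (X : Fin n → Matrix p p ℂ) :
    tensorPow Φ n (piKron X) = piKron fun t => Φ (X t) := by
  ext i j
  simp only [tensorPow, piKron, LinearMap.coe_mk, AddHom.coe_mk, Matrix.of_apply]
  simp only [superOp_apply Φ (X _), Finset.prod_univ_sum, Fintype.piFinset_univ,
    Finset.prod_mul_distrib]

/-- The Choi matrix of the power is a reordered tensor power of the Choi matrix. -/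
theorem IsCompletelyPositive.tensorPow [Fintype p] [DecidableEq p] [Fintype q]
    {Φ : SuperOp p q} (h : IsCompletelyPositive Φ) (n : ℕ) :
    IsCompletelyPositive (tensorPow Φ n) := by
  rw [isCompletelyPositive_iff] at *
  have : choiMatrix (PPTCode.tensorPow Φ n) =
      (piKron fun _ : Fin n => choiMatrix Φ).submatrix (fun x t => (x.1 t, x.2 t))
        (fun x t => (x.1 t, x.2 t)) := by
    ext x y
    simp only [choiMatrix, Matrix.of_apply, ← piKron_single, tensorPow_piKron]
    rfl
  rw [this]
  exact (piKron_posSemidef fun _ => h).submatrix _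

theorem IsChannel.tensorPow [Fintype p] [DecidableEq p] [Fintype q]
    {Φ : SuperOp p q} (h : IsChannel Φ) (n : ℕ) : IsChannel (tensorPow Φ n) := by
  refine ⟨h.1.tensorPow n, fun X => ?_⟩
  have : Matrix.traceLinearMap (Fin n → q) ℂ ℂ ∘ₗ PPTCode.tensorPow Φ n =
      Matrix.traceLinearMap (Fin n → p) ℂ ℂ :=
    piKron_ext fun X => by simp [trace_piKron, h.2]
  exact LinearMap.congr_fun this X

theorem choiState_tensorPow [Fintype p] [DecidableEq p] (N : SuperOp p q) (n : ℕ) :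
    choiState (tensorPow N n) = statePow (choiState N) n := by
  ext x y
  simp only [statePow, Matrix.of_apply, choiState_apply, Finset.prod_mul_distrib,
    ← piKron_single, tensorPow_piKron]
  simp [piKron]

end TensorPower

theorem one_le_floor_two_rpow {r : ℝ} (hr : 0 ≤ r) (n : ℕ) : 1 ≤ ⌊(2 : ℝ) ^ (r * n)⌋₊ :=
  Nat.le_floor (by simpa using Real.one_le_rpow one_le_two (mul_nonneg hr n.cast_nonneg))

theorem distillRate_le_codeCapacity {a b : Type*} [Fintype a] [DecidableEq a] [Nonempty a]
    [Fintype b] [DecidableEq b] [Nonempty b] {N : SuperOp a b} (hN : IsChannel N) :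
    distillRate (choiState N) ≤ codeCapacity N := by
  refine sSup_le_sSup (Set.image_mono ?_)
  rintro r ⟨hr, h⟩
  refine ⟨hr, tendsto_of_tendsto_of_tendsto_of_le_of_le h tendsto_const_nhds (fun n => ?_)
    fun n => codeFidelity_le_one (hN.tensorPow n) (one_le_floor_two_rpow hr n)⟩
  have := distillFidelity_le_codeFidelity (hN.tensorPow n) (one_le_floor_two_rpow hr n)
  rwa [choiState_tensorPow] at this

/-! ### Reduction to product operators, and contraction of positive matrices. -/

section Induction

variable {p q r s t u l : Type*}

/-- A form of `kron_ext` for one operator inside a formula, with no need to assemble both sides into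
linear maps. Scalars are absorbed into a factor, so additivity is enough. -/
theorem kron_induction [Finite p] [Finite q] {P : Matrix (p × q) (p × q) ℂ → Prop}
    (X : Matrix (p × q) (p × q) ℂ) (zero : P 0) (add : ∀ X Y, P X → P Y → P (X + Y))
    (kron : ∀ A B, P (A ⊗ₖ B)) : P X := by
  classical
  have := Fintype.ofFinite p
  have := Fintype.ofFinite q
  rw [Matrix.matrix_eq_sum_single X]
  refine Finset.sum_induction _ P add zero fun k _ => Finset.sum_induction _ P add zero
    fun m _ => ?_
  have := kron (Matrix.single k.1 m.1 1) (Matrix.single k.2 m.2 (X k m))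
  rwa [Matrix.single_kronecker_single, one_mul] at this

/-- Contraction of two positive semidefinite matrices along a shared system `l`. -/
theorem posSemidef_link [Finite s] [Finite t] [Finite u] [Fintype l]
    {P : Matrix s s ℂ} {Q : Matrix t t ℂ} (hP : P.PosSemidef) (hQ : Q.PosSemidef)
    (f : u → l → s) (g : u → l → t) {X : Matrix u u ℂ}
    (h : ∀ x y, X x y = ∑ c, ∑ d, P (f x c) (f y d) * Q (g x c) (g y d)) : X.PosSemidef := by
  have hR := (hP.kronecker hQ).submatrix (fun x : u × l => (f x.1 x.2, g x.1 x.2))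
  obtain ⟨m, v, hv⟩ := posSemidef_iff_exists_gram.1 hR
  -- The contraction compresses `P ⊗ Q` with the unnormalised maximally entangled vector of the
  -- shared system, so each Gram vector is summed over the shared index.
  refine posSemidef_of_gram (fun i x => ∑ c, v i (x, c)) fun x y => ?_
  have hv' : ∀ c d, P (f x c) (f y d) * Q (g x c) (g y d) =
      ∑ i, v i (x, c) * star (v i (y, d)) := fun c d => hv (x, c) (y, d)
  simp only [h, hv', star_sum, Finset.sum_mul_sum]
  rw [Finset.sum_congr rfl fun c _ => Finset.sum_comm, Finset.sum_comm]

theorem adjoin_add (ω ω' : Matrix (q × r) (q × r) ℂ) (X : Matrix p p ℂ) :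
    adjoin (ω + ω') X = adjoin ω X + adjoin ω' X := by
  simp [adjoin, Matrix.kronecker_add]

theorem adjoin_zero (X : Matrix p p ℂ) : adjoin (0 : Matrix (q × r) (q × r) ℂ) X = 0 := by
  simp [adjoin]

/-- Adjoining a fixed bipartite operator, as a linear map. -/
def adjoinMap (ω : Matrix (q × r) (q × r) ℂ) : SuperOp p ((p × q) × r) where
  toFun X := adjoin ω X
  map_add' X Y := by simp [adjoin, Matrix.add_kronecker]
  map_smul' c X := by simp [adjoin, Matrix.smul_kronecker]

end Induction

/-! ### From codes to distillation, by simulating the channel. -/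

section Simulation

variable {a b : Type*} [Fintype a] [DecidableEq a] [Fintype b] [DecidableEq b]

/-- `N` can be implemented from its Choi state by an operation with output on Bob's side that
stays completely positive under the transposition of Bob's systems. -/
def IsPPTSimulable (N : SuperOp a b) : Prop :=
  ∃ S : SuperOp ((a × a) × b) b, IsChannel S ∧ IsCompletelyPositive (decoderTranspose S) ∧
    ∀ X, S (adjoin (choiState N) X) = N X

/-- The classical message is diagonal, so it may be transposed for free. Then all inputs and outputs
of `D` are transposed, which preserves complete positivity. -/
theorem IsSimulableFromChoi.isPPTSimulable {N : SuperOp a b} (h : IsSimulableFromChoi N) :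
    IsPPTSimulable N := by
  obtain ⟨k, m, E, F, D, hE, hF, hF', hD, h⟩ := h
  refine ⟨D ∘ₗ mapTensor F LinearMap.id ∘ₗ mapTensor E LinearMap.id,
    hD.comp ((hF.mapTensor .id).comp (hE.mapTensor .id)), ?_, h⟩
  have hFt : ∀ A, (F A)ᵀ = F A := fun A => by
    have := LinearMap.congr_fun hF'.2 A
    rw [← this]
    simp [dephase]
  have : decoderTranspose (D ∘ₗ mapTensor F LinearMap.id ∘ₗ mapTensor E LinearMap.id) =
      (transposeMap b ∘ₗ D ∘ₗ transposeMap (Fin m × b)) ∘ₗ mapTensor F LinearMap.id ∘ₗ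
        mapTensor E LinearMap.id :=
    kron_ext fun A B => by
      simp [decoderTranspose, ← Matrix.kroneckerMap_transpose, hFt]
  rw [this]
  exact hD.1.transpose_conj.comp ((hF.1.mapTensor .id).comp (hE.1.mapTensor .id))

/-- Regrouping the tensor powers of three systems into a tensor power of their product. -/
def powEquiv (n : ℕ) (p q r : Type*) :
    ((Fin n → p) × (Fin n → q)) × (Fin n → r) ≃ (Fin n → (p × q) × r) where
  toFun x t := ((x.1.1 t, x.1.2 t), x.2 t)
  invFun x := ((fun t => (x t).1.1, fun t => (x t).1.2), fun t => (x t).2)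
  left_inv _ := rfl
  right_inv _ := rfl

/-- The simulation is applied copy by copy; transposition and adjoining the Choi state are
compatible with the regrouping of factors. -/
theorem IsPPTSimulable.tensorPow {N : SuperOp a b} (h : IsPPTSimulable N) (n : ℕ) :
    IsPPTSimulable (tensorPow N n) := by
  obtain ⟨S, hS, hS', h⟩ := h
  refine ⟨PPTCode.tensorPow S n ∘ₗ relabel (powEquiv n a a b),
    (hS.tensorPow n).comp (.relabel _), ?_, fun X => ?_⟩
  · have : decoderTranspose (PPTCode.tensorPow S n ∘ₗ relabel (powEquiv n a a b)) ∘ₗ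
          relabel (powEquiv n a a b).symm =
        PPTCode.tensorPow (decoderTranspose S) n :=
      piKron_ext fun X => by
        have hT : relabel (powEquiv n a a b) (partialTransposeMap _ _
            (relabel (powEquiv n a a b).symm (piKron X))) =
            piKron fun t => partialTransposeMap _ _ (X t) := rfl
        simp only [decoderTranspose, LinearMap.comp_apply, hT, tensorPow_piKron]
        rfl
    have h' := (hS'.tensorPow n).comp (IsCompletelyPositive.relabel (powEquiv n a a b))
    rw [← this] at h'
    exact h'
  · have : PPTCode.tensorPow S n ∘ₗ relabel (powEquiv n a a b) ∘ₗ
        adjoinMap (statePow (choiState N) n) = PPTCode.tensorPow N n :=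
      piKron_ext fun X => by
        have hT : relabel (powEquiv n a a b) (adjoinMap (statePow (choiState N) n) (piKron X)) =
            piKron fun t => adjoin (choiState N) (X t) := by
          ext x y
          simp [adjoinMap, adjoin, powEquiv, statePow, piKron, Finset.prod_mul_distrib]
        simp only [LinearMap.comp_apply, hT, tensorPow_piKron, h]
    have := LinearMap.congr_fun this X
    rw [choiState_tensorPow]
    exact this

/-- Regrouping the output of an encoder and a bipartite system for use by a simulation. -/
def simulationEquiv (p q r s : Type*) : (p × q) × (r × s) ≃ q × ((p × r) × s) where
  toFun x := (x.1.2, ((x.1.1, x.2.1), x.2.2))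
  invFun x := ((x.2.1.1, x.1), (x.2.1.2, x.2.2))
  left_inv _ := rfl
  right_inv _ := rfl

theorem relabel_simulationEquiv_kron {p q r s : Type*} (A : Matrix p p ℂ) (B : Matrix q q ℂ)
    (W : Matrix (r × s) (r × s) ℂ) :
    relabel (simulationEquiv p q r s) ((A ⊗ₖ B) ⊗ₖ W) = B ⊗ₖ adjoin W A := by
  ext i j
  simp [simulationEquiv, adjoin]
  ring

/-- The operation that results from using a code with the channel replaced by a
simulation `S` that acts on an additional bipartite system. -/
def ForwardCode.simulate {K : ℕ} (C : ForwardCode a b K) (S : SuperOp ((a × a) × b) b) :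
    SuperOp (Fin K × (a × b)) (Fin K) :=
  C.dec ∘ₗ mapTensor C.side (LinearMap.id : SuperOp b b) ∘ₗ
    mapTensor (LinearMap.id : SuperOp (Fin C.dimQ) (Fin C.dimQ)) S ∘ₗ
    relabel (simulationEquiv a (Fin C.dimQ) a b) ∘ₗ
    mapTensor C.enc (LinearMap.id : SuperOp (a × b) (a × b))

variable {K : ℕ} (C : ForwardCode a b K) {S : SuperOp ((a × a) × b) b}

theorem ForwardCode.isChannel_simulate (hS : IsChannel S) : IsChannel (C.simulate S) :=
  C.dec_isChannel.comp ((C.side_isChannel.mapTensor .id).comp ((IsChannel.id.mapTensor hS).comp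
    ((IsChannel.relabel _).comp (C.enc_isChannel.mapTensor .id))))

theorem ForwardCode.simulate_choiState {N : SuperOp a b}
    (h : ∀ X, S (adjoin (choiState N) X) = N X) (X : Matrix (Fin K) (Fin K) ℂ) :
    C.simulate S (X ⊗ₖ choiState N) = C.apply N X := by
  simp only [ForwardCode.simulate, ForwardCode.apply, LinearMap.comp_apply, mapTensor_kron,
    LinearMap.id_apply]
  induction C.enc X using kron_induction with
  | zero => simp
  | add E E' h₁ h₂ => simp only [Matrix.add_kronecker, map_add, h₁, h₂]
  | kron A Q => simp [relabel_simulationEquiv_kron, h]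

/-- Expanding the intermediate systems `A'` and `B` in matrix units separates the code from the
simulation; `c` and `d` are the row and column indices of `A'B`. -/
theorem ForwardCode.simulate_kron_apply (S : SuperOp ((a × a) × b) b)
    (X : Matrix (Fin K) (Fin K) ℂ) (W : Matrix (a × b) (a × b) ℂ) (i j : Fin K) :
    C.simulate S (X ⊗ₖ W) i j = ∑ c : a × b, ∑ d : a × b,
      C.bipartite (X ⊗ₖ Matrix.single c.2 d.2 1) (c.1, i) (d.1, j) *
        S (adjoin W (Matrix.single c.1 d.1 1)) c.2 d.2 := by
  simp only [ForwardCode.simulate, ForwardCode.bipartite, LinearMap.comp_apply, mapTensor_kron,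
    LinearMap.id_apply]
  induction C.enc X using kron_induction with
  | zero => simp
  | add E E' h₁ h₂ =>
    simp only [Matrix.add_kronecker, map_add, Matrix.add_apply, h₁, h₂, add_mul,
      Finset.sum_add_distrib]
  | kron A Q =>
    have h₁ := superOp_apply (C.dec ∘ₗ prepare (C.side Q)) (S (adjoin W A)) i j
    have h₂ : ∀ γ δ, S (adjoin W A) γ δ =
        ∑ c, ∑ d, S (adjoin W (Matrix.single c d 1)) γ δ * A c d := fun γ δ =>
      superOp_apply (S ∘ₗ adjoinMap W) A γ δ
    simp only [LinearMap.comp_apply, prepare_apply] at h₁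
    simp only [relabel_simulationEquiv_kron, mapTensor_kron, LinearMap.id_apply, h₁, h₂,
      relabel_prodAssoc_kron, Matrix.kroneckerMap_apply, Fintype.sum_prod_type, Finset.mul_sum]
    rw [Finset.sum_congr rfl fun _ _ => Finset.sum_comm, Finset.sum_comm]
    refine Finset.sum_congr rfl fun c _ => Finset.sum_congr rfl fun γ _ => ?_
    rw [Finset.sum_comm]
    refine Finset.sum_congr rfl fun d _ => Finset.sum_congr rfl fun δ _ => ?_
    ring

/-- The Choi matrix is the contraction over `A'B` of those of `transposeConj C.bipartite` and
`decoderTranspose S`. System `B` is an output of the simulation and an input of the code, so it is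
transposed in both. -/
theorem ForwardCode.simulate_transpose [Nonempty b]
    (hC : IsPPTPreserving C.bipartite) (hK : 1 ≤ K)
    (hS : IsCompletelyPositive (decoderTranspose S)) :
    IsCompletelyPositive (transposeMap (Fin K) ∘ₗ C.simulate S ∘ₗ
      mapTensor LinearMap.id (partialTransposeMap a b)) := by
  have : Nonempty (Fin K) := ⟨⟨0, hK⟩⟩
  have hZ := isCompletelyPositive_iff.1 hC.transposeConj
  rw [isCompletelyPositive_iff] at hS ⊢
  refine posSemidef_link (l := a × b) hZ hS (fun x c => ((c.1, x.1), (x.2.1, c.2)))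
    (fun x c => (c.2, ((c.1, x.2.2.1), x.2.2.2))) ?_
  rintro ⟨j, k, x, β⟩ ⟨j', k', x', β'⟩
  have hs : (Matrix.single (k, x, β) (k', x', β') 1 : Matrix (Fin K × a × b) (Fin K × a × b) ℂ) =
      Matrix.single k k' 1 ⊗ₖ Matrix.single (x, β) (x', β') 1 := by
    rw [Matrix.single_kronecker_single, mul_one]
  have hs' : ∀ γ δ : b, Matrix.single k k' (1 : ℂ) ⊗ₖ Matrix.single γ δ 1 =
      Matrix.single (k, γ) (k', δ) 1 := fun γ δ => by
    rw [Matrix.single_kronecker_single, mul_one]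
  have hs'' : ∀ c d : a, adjoin (Matrix.single (x, β') (x', β) (1 : ℂ)) (Matrix.single c d 1) =
      Matrix.single ((c, x), β') ((d, x'), β) 1 := fun c d => by
    have := adjoin_kron (Matrix.single c d (1 : ℂ)) (Matrix.single x x' 1) (Matrix.single β' β 1)
    simpa [Matrix.single_kronecker_single] using this
  rw [choiMatrix, Matrix.of_apply, hs, LinearMap.comp_apply, LinearMap.comp_apply,
    mapTensor_kron, LinearMap.id_apply, partialTransposeMap_single, transposeMap_apply,
    Matrix.transpose_apply, ForwardCode.simulate_kron_apply]
  simp only [choiMatrix, Matrix.of_apply, hs', hs'', transposeConj, decoderTranspose,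
    LinearMap.comp_apply, partialTransposeMap_single, transposeMap_apply, Matrix.transpose_apply,
    Fintype.sum_prod_type]
  refine Finset.sum_congr rfl fun c _ => ?_
  -- The two transpositions of `B` amount to exchanging its row and column summation indices.
  exact Finset.sum_comm.trans
    ((Finset.sum_congr rfl fun _ _ => Finset.sum_comm).trans Finset.sum_comm)

/-- Distillation by applying a code, with the channel replaced by a simulation, to half of a
locally prepared maximally entangled state. -/
noncomputable def ForwardCode.distillation (S : SuperOp ((a × a) × b) b) :
    SuperOp (a × b) (Fin K × Fin K) :=
  mapTensor LinearMap.id (C.simulate S) ∘ₗ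
    relabel (Equiv.prodAssoc (Fin K) (Fin K) (a × b)) ∘ₗ prepare (maxEnt (Fin K))

theorem ForwardCode.transposeConj_distillation (S : SuperOp ((a × a) × b) b) :
    transposeConj (C.distillation S) =
      mapTensor LinearMap.id (transposeMap (Fin K) ∘ₗ C.simulate S ∘ₗ
        mapTensor LinearMap.id (partialTransposeMap a b)) ∘ₗ
      relabel (Equiv.prodAssoc (Fin K) (Fin K) (a × b)) ∘ₗ prepare (maxEnt (Fin K)) := by
  ext1 X
  simp only [transposeConj, ForwardCode.distillation, LinearMap.comp_apply, prepare_apply]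
  induction maxEnt (Fin K) using kron_induction with
  | zero => simp
  | add E E' h₁ h₂ => simp only [Matrix.add_kronecker, map_add, h₁, h₂]
  | kron A B => simp

theorem ForwardCode.distillation_choiState {N : SuperOp a b}
    (h : ∀ X, S (adjoin (choiState N) X) = N X) :
    C.distillation S (choiState N) = choiState (C.apply N) := by
  -- Only this Choi state is unfolded: the induction replaces the `φ` of size `K` on both sides and
  -- must leave `choiState N` intact.
  rw [choiState.eq_def (C.apply N)]
  simp only [ForwardCode.distillation, LinearMap.comp_apply, prepare_apply]
  induction maxEnt (Fin K) using kron_induction with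
  | zero => simp
  | add E E' h₁ h₂ => simp only [Matrix.add_kronecker, map_add, h₁, h₂]
  | kron A B => simp [C.simulate_choiState h]

theorem IsPPTSimulable.distills [Nonempty b] {N : SuperOp a b} (h : IsPPTSimulable N)
    (hK : 1 ≤ K) {f : ℝ} (hf : CodeAchieves N K f) : Distills (choiState N) K f := by
  obtain ⟨C, hC, rfl⟩ := hf
  obtain ⟨S, hS, hS', h⟩ := h
  have : Nonempty (Fin K) := ⟨⟨0, hK⟩⟩
  refine ⟨C.distillation S, ?_, isPPTPreserving_of_transposeConj ?_, ?_⟩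
  · exact (IsChannel.id.mapTensor (C.isChannel_simulate hS)).comp
      ((IsChannel.relabel _).comp (.prepare isState_maxEnt))
  · rw [C.transposeConj_distillation]
    exact (IsCompletelyPositive.id.mapTensor (C.simulate_transpose hC hK hS')).comp
      ((IsCompletelyPositive.relabel _).comp (IsChannel.prepare isState_maxEnt).1)
  · rw [C.distillation_choiState h, channelFidelity_eq_choiState]

theorem IsPPTSimulable.codeAchieves_iff [Nonempty a] [Nonempty b] {N : SuperOp a b}
    (h : IsPPTSimulable N) (hK : 1 ≤ K) {f : ℝ} :
    CodeAchieves N K f ↔ Distills (choiState N) K f :=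
  ⟨h.distills hK, codeAchieves_of_distills hK⟩

theorem IsPPTSimulable.codeFidelity_eq [Nonempty a] [Nonempty b] {N : SuperOp a b}
    (h : IsPPTSimulable N) (hK : 1 ≤ K) :
    codeFidelity N K = distillFidelity (choiState N) K := by
  simp only [codeFidelity, distillFidelity, h.codeAchieves_iff hK]

theorem IsPPTSimulable.codeCapacity_eq [Nonempty a] [Nonempty b] {N : SuperOp a b}
    (h : IsPPTSimulable N) : codeCapacity N = distillRate (choiState N) := by
  have h' : ∀ r : ℝ, 0 ≤ r → ∀ n : ℕ,
      codeFidelity (PPTCode.tensorPow N n) ⌊(2 : ℝ) ^ (r * n)⌋₊ =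
        distillFidelity (statePow (choiState N) n) ⌊(2 : ℝ) ^ (r * n)⌋₊ := fun r hr n => by
    rw [(h.tensorPow n).codeFidelity_eq (one_le_floor_two_rpow hr n), choiState_tensorPow]
  rw [codeCapacity, distillRate]
  congr 2
  ext r
  refine and_congr_right fun hr => ?_
  simp only [h' r hr]

end Simulation

/-! ### Teleportation-covariant channels. -/

section Covariance

variable {p q : Type*} [Fintype p] [DecidableEq p]

/-- The Kraus operators of a measurement of the first factor followed by a unitary on the second. -/
def controlledKraus {k : ℕ} (W : Fin k → Matrix.unitaryGroup p ℂ) (i : Fin k) :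
    Matrix p (Fin k × p) ℂ :=
  Matrix.of fun j x => if x.1 = i then (W i : Matrix p p ℂ) j x.2 else 0

theorem krausMap_controlledKraus {k : ℕ} (W : Fin k → Matrix.unitaryGroup p ℂ)
    (X : Matrix (Fin k × p) (Fin k × p) ℂ) :
    krausMap (controlledKraus W) X = controlled W X := by
  ext i j
  simp [krausMap_apply, controlled, Matrix.sum_apply, Matrix.mul_apply, controlledKraus,
    Fintype.sum_prod_type, apply_ite]

theorem isChannel_controlledKraus {k : ℕ} (W : Fin k → Matrix.unitaryGroup p ℂ) :
    IsChannel (krausMap (controlledKraus W)) := by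
  refine isChannel_krausMap _ ?_
  ext ⟨i, x⟩ ⟨j, y⟩
  have h : ∀ i, ∑ z, star ((W i : Matrix p p ℂ) z x) * (W i : Matrix p p ℂ) z y =
      if x = y then 1 else 0 := fun i => by
    have := congrFun (congrFun (Matrix.UnitaryGroup.star_mul_self (W i)) x) y
    simpa [Matrix.mul_apply, Matrix.one_apply, Matrix.star_apply] using this
  rw [Matrix.sum_apply, Finset.sum_eq_single i]
  · by_cases hij : i = j
    · subst hij
      simpa [controlledKraus, Matrix.mul_apply, Matrix.one_apply] using h i
    · simp [controlledKraus, Matrix.mul_apply, hij, Ne.symm hij]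
  · intro c _ hc
    simp [controlledKraus, Matrix.mul_apply, Ne.symm hc]
  · simp

theorem isChannel_dephase (p : Type*) [Fintype p] [DecidableEq p] : IsChannel (dephase p) := by
  refine ⟨.of_kraus (fun i : p => Matrix.single i i 1) fun X => ?_, fun X => ?_⟩
  · ext i j
    simp [dephase, Matrix.sum_apply, Matrix.single_apply, Matrix.diagonal_apply,
      ite_and]
  · simp [dephase, Matrix.trace]

theorem isClassical_dephase (p : Type*) [DecidableEq p] : IsClassical (dephase p) := by
  constructor <;> ext1 X <;> simp [dephase]

/-- Dephasing fixes the diagonal blocks, and `N` acts on each block separately. -/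
theorem mapTensor_dephase_submatrix {k : ℕ} (N : SuperOp p q)
    (X : Matrix (Fin k × p) (Fin k × p) ℂ) (i : Fin k) :
    (mapTensor (dephase (Fin k)) N X).submatrix (fun j => (i, j)) (fun j => (i, j)) =
      N (X.submatrix (fun j => (i, j)) (fun j => (i, j))) := by
  induction X using kron_induction with
  | zero => simp
  | add X Y h₁ h₂ => simp only [map_add, Matrix.submatrix_add, Pi.add_apply, h₁, h₂]
  | kron A B =>
    have : (A ⊗ₖ B).submatrix (fun j => (i, j)) (fun j => (i, j)) = A i i • B := by
      ext; simp
    rw [this, map_smul]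
    ext
    simp [dephase]

theorem isSimulableFromChoi_of_teleportation {a b : Type*} [Fintype a] [DecidableEq a]
    [Fintype b] [DecidableEq b] {N : SuperOp a b} {k : ℕ} {M : SuperOp (a × a) (Fin k)}
    {U : Fin k → Matrix.unitaryGroup a ℂ} {V : Fin k → Matrix.unitaryGroup b ℂ}
    (hM : IsTeleportation M U)
    (hN : ∀ (i : Fin k) (X : Matrix a a ℂ),
      N ((U i : Matrix a a ℂ) * X * (U i : Matrix a a ℂ)ᴴ) =
        (V i : Matrix b b ℂ) * N X * (V i : Matrix b b ℂ)ᴴ) :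
    IsSimulableFromChoi N := by
  refine ⟨k, k, M, dephase (Fin k), krausMap (controlledKraus V), hM.1, isChannel_dephase _,
    isClassical_dephase _, isChannel_controlledKraus V, fun X => ?_⟩
  -- The channel inside the Choi state commutes with Alice's measurement, so it may be applied to
  -- Bob's half of `φ` afterwards.
  have h : mapTensor (dephase (Fin k)) (LinearMap.id : SuperOp b b)
      (mapTensor M LinearMap.id (adjoin (choiState N) X)) =
      mapTensor (dephase (Fin k)) N (mapTensor M LinearMap.id (adjoin (maxEnt a) X)) := by
    rw [choiState]
    induction maxEnt a using kron_induction with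
    | zero => simp [adjoin_zero]
    | add E E' h₁ h₂ => simp only [map_add, adjoin_add, h₁, h₂]
    | kron A B => simp
  rw [h, krausMap_controlledKraus, controlled]
  simp only [mapTensor_dephase_submatrix, ← hN]
  rw [← map_sum]
  exact congrArg N (hM.2 X)

end Covariance

end PPTCode

theorem mainTheorem4 {a b : Type*} [Fintype a] [DecidableEq a] [Nonempty a]
    [Fintype b] [DecidableEq b]
    (N : PPTCode.SuperOp a b) (hN : PPTCode.IsChannel N) :
    ((∀ (K : ℕ) (f : ℝ), 1 ≤ K →
          PPTCode.Distills (PPTCode.choiState N) K f → PPTCode.CodeAchieves N K f) ∧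
      (∀ K : ℕ, 1 ≤ K →
          PPTCode.distillFidelity (PPTCode.choiState N) K ≤ PPTCode.codeFidelity N K) ∧
      PPTCode.distillRate (PPTCode.choiState N) ≤ PPTCode.codeCapacity N) ∧
    (PPTCode.IsSimulableFromChoi N →
      (∀ (K : ℕ) (f : ℝ), 1 ≤ K →
          (PPTCode.CodeAchieves N K f ↔ PPTCode.Distills (PPTCode.choiState N) K f)) ∧
      (∀ K : ℕ, 1 ≤ K →
          PPTCode.codeFidelity N K = PPTCode.distillFidelity (PPTCode.choiState N) K) ∧
      PPTCode.codeCapacity N = PPTCode.distillRate (PPTCode.choiState N)) ∧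
    (∀ (k : ℕ) (M : PPTCode.SuperOp (a × a) (Fin k))
        (U : Fin k → Matrix.unitaryGroup a ℂ) (V : Fin k → Matrix.unitaryGroup b ℂ),
        PPTCode.IsTeleportation M U →
        (∀ (i : Fin k) (X : Matrix a a ℂ),
          N ((U i : Matrix a a ℂ) * X * (U i : Matrix a a ℂ)ᴴ) =
            (V i : Matrix b b ℂ) * N X * (V i : Matrix b b ℂ)ᴴ) →
        PPTCode.IsSimulableFromChoi N) := by
  -- Trace preservation excludes an empty output system.
  have := hN.nonempty
  refine ⟨⟨fun K f hK h => PPTCode.codeAchieves_of_distills hK h,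
    fun K hK => PPTCode.distillFidelity_le_codeFidelity hN hK,
    PPTCode.distillRate_le_codeCapacity hN⟩, fun h => ?_,
    fun k M U V hM hV => PPTCode.isSimulableFromChoi_of_teleportation hM hV⟩
  have h' := h.isPPTSimulable
  exact ⟨fun K f hK => h'.codeAchieves_iff hK, fun K hK => h'.codeFidelity_eq hK,
    h'.codeCapacity_eq⟩
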